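/- Let $q\in\mathbb C^*$, $N\ge 1$, $\tau\in\{1,-1\}$, and $\Lambda(q)=\{n\in\mathbb Z: q^n=1\}$. Let $\mathbb C_q$ be the quantum torus with basis $x^my^n$ ($m,n\in\mathbb Z$) and $yx=q\,xy$, and let $\bar{\ }$ be its $\mathbb C$-linear anti-involution with $\bar x=x$, $\bar y=y^{-1}$. **The Lie superalgebra.** Let $gl(1,2N)(\mathbb C_q)$ be the Lie superalgebra of matrices over $\mathbb C_q$ with rows and columns indexed by $0,1,\dots,2N$ ($0$ even, the other indices odd), and let $\widehat{gl}=gl(1,2N)(\mathbb C_q)\oplus\bigoplus_{n\in\Lambda(q)}\mathbb C c(n)\oplus\mathbb C c_y$ be its central extension with $$[A x^my^n,Bx^py^s]_s=(Ax^my^n)(Bx^py^s)-(-1)^{\deg A\deg B}(Bx^py^s)(Ax^my^n)+\delta_{m+p,0}\,q^{np}\,\mathrm{str}(AB)\bigl(m\,[n+s\in\Lambda(q)]\,c(n+s)+n\,\delta_{n+s,0}\,c_y\bigr),$$ where $\mathrm{str}(M)=M_{00}-\sum_{i\ge1}M_{ii}$ and $[P]$ is $1$ if $P$ holds and $0$ otherwise.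 Put $J=\mathrm{diag}(1,-I_{2N})$ and $G=\mathrm{diag}\bigl(1,\begin{pmatrix}0&I_N\\-I_N&0\end{pmatrix}\bigr)$. Let $\mathcal S=\mathcal S_{\bar0}\oplus\mathcal S_{\bar1}$ with $\mathcal S_{\bar0}=\{X\text{ even}:\bar X^tG+GX=0\}$ and $\mathcal S_{\bar1}=\{X\text{ odd}:\bar X^tG-JGX=0\}$, let $\mathcal G=[\mathcal S,\mathcal S]_s$, and let $\widehat{\mathcal S}$ and $\widehat{\mathcal G}\subseteq\widehat{\mathcal S}$ be the subalgebras $\mathcal S\oplus\bigoplus_n\mathbb Cc(n)\oplus\mathbb Cc_y$ and $\mathcal G\oplus\bigoplus_n\mathbb Cc(n)\oplus\mathbb Cc_y$ of $\widehat{gl}$. For $1\le i,j\le N$ and $m,n\in\mathbb Z$, with $u=x^my^n$, the following elements span $\mathcal S$: $$\tilde g_{ij}(m,n)=u\,e_{i,N+j}+\bar u\,e_{j,N+i},\quad \tilde f_{ij}(m,n)=u\,e_{ij}-\bar u\,e_{N+j,N+i},\quad \tilde h_{ij}(m,n)=-u\,e_{N+i,j}-\bar u\,e_{N+j,i},$$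 $$\tilde e_i(m,n)=-u\,e_{i,0}-\bar u\,e_{0,N+i},\quad \tilde e_i^*(m,n)=u\,e_{N+i,0}-\bar u\,e_{0,i},\quad \tilde e_0(m,n)=-(u-\bar u)e_{00}.$$ **The Fock space.** Let $\alpha_\tau(N)$ be the unital associative algebra with generators $a_i(m),a_i^*(m),e(m)$ ($1\le i\le N$, $m\in\mathbb Z$) and relations $[a_i(m),a_j(n)]=[a_i^*(m),a_j^*(n)]=0$, $[a_i(m),a_j^*(n)]=-\delta_{ij}\delta_{m+n,0}$, $e(m)e(n)+e(n)e(m)=-\delta_{m+n,0}$, $a_i(m)e(n)+\tau e(n)a_i(m)=0=a_i^*(m)e(n)+\tau e(n)a_i^*(m)$. Let $V(N,-)$ be the simple module of the subalgebra of bosons with vacuum vector $v_0$ killed by $a_i(m)$ $(m>0)$ and $a_i^*(m)$ $(m\ge0)$, realised as the polynomial algebra on the creation operators $a_i(m)$ $(m\le 0)$, $a_i^*(m)$ $(m<0)$. Let $V_0$ be a simple Clifford module with vacuum vector $v_0'$ killed by $e(m)$ $(m>0)$ and with $e(0)v_0'=\lambda v_0'$ (so $\lambda^2=-\frac12$; both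 values of $\lambda$ are allowed), realised as the exterior algebra on the creation operators $e(m)$ $(m<0)$. Then $V_\tau(N)=V(N,-)\otimes V_0$ is an $\alpha_\tau(N)$-module: $a_i(m),a_i^*(m)$ act on the first factor, and $e(m)$ acts as $P_\tau\otimes e(m)$, where $P_\tau$ multiplies polynomials of degree $d$ by $(-\tau)^d$. **The operators.** Normal ordering is $:u(m)v(n):\;=u(m)v(n)$ if $m<n$, $\;\varepsilon\, v(n)u(m)$ if $m>n$, and $\frac12\bigl(u(m)v(n)+\varepsilon v(n)u(m)\bigr)$ if $m=n$, with $\varepsilon=1$ for two bosons and $\varepsilon=-1$ for two fermions $e$; moreover $:a_i(m)e(n):\;=a_i(m)e(n)$ and $:a_i^*(m)e(n):\;=a_i^*(m)e(n)$. Put $$f_{ij}(m,n)=\sum_{s\in\mathbb Z}q^{-ns}:a_i(m-s)a_j^*(s):,\quad g_{ij}(m,n)=\sum_{s\in\mathbb Z}q^{-ns}:a_i(m-s)a_j(s):,\quad h_{ij}(m,n)=\sum_{s\in\mathbb Z}q^{-ns}:a_i^*(m-s)a_j^*(s):,$$ $$e_i(m,n)=\sum_{s\in\mathbb Z}q^{-ns}:a_i(m-s)e(s):,\quad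 e_i^*(m,n)=\sum_{s\in\mathbb Z}q^{-ns}:a_i^*(m-s)e(s):,\quad e_0(m,n)=\sum_{s\in\mathbb Z}q^{-ns}:e(m-s)e(s):.$$ Let $\sigma(m,n)=0$ if $n\in\Lambda(q)$ and $\sigma(m,n)=\frac12\delta_{m,0}\frac{q^n+1}{q^n-1}$ otherwise, and put $F_{ij}(m,n)=f_{ij}(m,n)+\delta_{ij}\sigma(m,n)$, $E_0(m,n)=e_0(m,n)+\sigma(m,n)$, $G_{ij}=g_{ij}$, $H_{ij}=h_{ij}$, $E_i=e_i$, $E_i^*=e_i^*$. **Theorem.** All these sums are locally finite on $V_\tau(N)$, and there is a linear map $\pi:\widehat{\mathcal S}\to\mathrm{End}(V_\tau(N))$ with $$\pi(\tilde g_{ij}(m,n))=\tau G_{ij}(m,n),\quad \pi(\tilde f_{ij}(m,n))=F_{ij}(m,n),\quad \pi(\tilde h_{ij}(m,n))=\tau H_{ij}(m,n),$$ $$\pi(\tilde e_i(m,n))=\tau E_i(m,n),\quad \pi(\tilde e_i^*(m,n))=E_i^*(m,n),\quad \pi(\tilde e_0(m,n))=E_0(m,n),$$ $$\pi(c(n))=\tfrac12\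 \ (n\in\Lambda(q)),\qquad \pi(c_y)=0,$$ which makes $V_\tau(N)$ a module for the Lie superalgebra $\widehat{\mathcal S}$, and hence, by restriction, for $\widehat{\mathcal G}$. That is, $V_\tau(N)$ has a $\mathbb Z/2$-grading for which $\pi$ is even, and $\pi([X,Y]_s)=\pi(X)\pi(Y)-(-1)^{\deg X\deg Y}\pi(Y)\pi(X)$ for homogeneous $X,Y$. -/

import Mathlib

open scoped TensorProduct Matrix

noncomputable section

namespace QT

set_option linter.unusedSimpArgs false
set_option linter.unnecessarySeqFocus false

/-! ### The quantum torus -/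

/-- The quantum torus `ℂ_q` with its basis of monomials `x ^ m * y ^ n`, `(m, n) ∈ ℤ × ℤ`. -/
def QTorus (_q : ℂˣ) : Type := ℤ × ℤ →₀ ℂ

instance (q : ℂˣ) : AddCommGroup (QTorus q) := inferInstanceAs (AddCommGroup (ℤ × ℤ →₀ ℂ))

instance (q : ℂˣ) : Module ℂ (QTorus q) := inferInstanceAs (Module ℂ (ℤ × ℤ →₀ ℂ))

/-- The monomial `x ^ m * y ^ n`. -/
def mono (q : ℂˣ) (m n : ℤ) : QTorus q := (Finsupp.single (m, n) 1 : ℤ × ℤ →₀ ℂ)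

/-- The linear map on the quantum torus with prescribed values on the monomials. -/
def lin (q : ℂˣ) {M : Type*} [AddCommGroup M] [Module ℂ M] (f : ℤ → ℤ → M) :
    QTorus q →ₗ[ℂ] M :=
  Finsupp.linearCombination ℂ (fun a : ℤ × ℤ => f a.1 a.2)

@[simp] lemma lin_mono (q : ℂˣ) {M : Type*} [AddCommGroup M] [Module ℂ M] (f : ℤ → ℤ → M)
    (m n : ℤ) : lin q f (mono q m n) = f m n := by
  unfold lin mono
  erw [Finsupp.linearCombination_single]
  simp

lemma lin_ext {q : ℂˣ} {M : Type*} [AddCommGroup M] [Module ℂ M] {f g : QTorus q →ₗ[ℂ] M}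
    (h : ∀ m n, f (mono q m n) = g (mono q m n)) : f = g :=
  Finsupp.lhom_ext' fun a => LinearMap.ext_ring (h a.1 a.2)

/-- `q ^ k` as a complex number. -/
def qpow (q : ℂˣ) (k : ℤ) : ℂ := ((q ^ k : ℂˣ) : ℂ)

lemma qpow_add (q : ℂˣ) (k l : ℤ) : qpow q (k + l) = qpow q k * qpow q l := by
  simp [qpow, zpow_add]

@[simp] lemma qpow_zero (q : ℂˣ) : qpow q 0 = 1 := by simp [qpow]

/-- The product: `(x ^ m * y ^ n) * (x ^ p * y ^ s) = q ^ (n * p) x ^ (m + p) * y ^ (n + s)`,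
which is the consequence of `y * x = q x * y`. -/
def mulL (q : ℂˣ) : QTorus q →ₗ[ℂ] QTorus q →ₗ[ℂ] QTorus q :=
  lin q fun m n => lin q fun p s => qpow q (n * p) • mono q (m + p) (n + s)

instance (q : ℂˣ) : Mul (QTorus q) := ⟨fun f g => mulL q f g⟩

instance (q : ℂˣ) : One (QTorus q) := ⟨mono q 0 0⟩

lemma mul_def {q : ℂˣ} (f g : QTorus q) : f * g = mulL q f g := rfl

lemma mono_mul_mono (q : ℂˣ) (m n p s : ℤ) :
    mono q m n * mono q p s = qpow q (n * p) • mono q (m + p) (n + s) := by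
  simp [mul_def, mulL]

lemma one_mul_aux {q : ℂˣ} (f : QTorus q) : mono q 0 0 * f = f := by
  have h : mulL q (mono q 0 0) = LinearMap.id := by
    refine lin_ext fun m n => ?_
    simp [mulL]
  exact congrArg (fun L => L f) h

lemma mul_one_aux {q : ℂˣ} (f : QTorus q) : f * mono q 0 0 = f := by
  have h : (mulL q).flip (mono q 0 0) = LinearMap.id := by
    refine lin_ext fun m n => ?_
    simp [mulL]
  exact congrArg (fun L => L f) h

lemma mul_assoc_aux {q : ℂˣ} (f g h : QTorus q) : f * g * h = f * (g * h) := by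
  have key : (LinearMap.llcomp ℂ (QTorus q) (QTorus q) (QTorus q →ₗ[ℂ] QTorus q) (mulL q)).comp
      (mulL q) = ((LinearMap.llcomp ℂ (QTorus q) (QTorus q) (QTorus q)).flip.comp
        (mulL q)).flip.comp (mulL q) := by
    refine lin_ext fun m n => lin_ext fun p s => lin_ext fun k l => ?_
    simp only [LinearMap.comp_apply, LinearMap.llcomp_apply, LinearMap.flip_apply, mulL, lin_mono,
      map_smul, LinearMap.smul_apply, smul_smul, ← qpow_add]
    congr 2
    · ring
    · ring
    · ring
  exact congrArg (fun L => L f g h) key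

instance (q : ℂˣ) : Ring (QTorus q) :=
  { (inferInstance : AddCommGroup (QTorus q)),
    (inferInstance : Mul (QTorus q)),
    (inferInstance : One (QTorus q)) with
    left_distrib := fun f g h => by simp [mul_def]
    right_distrib := fun f g h => by simp [mul_def]
    zero_mul := fun f => by simp [mul_def]
    mul_zero := fun f => by simp [mul_def]
    mul_assoc := mul_assoc_aux
    one_mul := one_mul_aux
    mul_one := mul_one_aux }

/-- The `ℂ`-linear anti-involution with `x ↦ x`, `y ↦ y⁻¹`, so that
`x ^ m * y ^ n ↦ y ^ (-n) * x ^ m = q ^ (-(n * m)) x ^ m * y ^ (-n)`. -/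
def bar (q : ℂˣ) : QTorus q →ₗ[ℂ] QTorus q :=
  lin q fun m n => qpow q (-(n * m)) • mono q m (-n)

lemma bar_bar {q : ℂˣ} (f : QTorus q) : bar q (bar q f) = f := by
  have h : (bar q).comp (bar q) = LinearMap.id := by
    refine lin_ext fun m n => ?_
    simp [bar, smul_smul, ← qpow_add]
  exact congrArg (fun L => L f) h

lemma bar_mul {q : ℂˣ} (f g : QTorus q) : bar q (f * g) = bar q g * bar q f := by
  have h : (mulL q).compr₂ (bar q) = ((mulL q).compl₁₂ (bar q) (bar q)).flip := by
    refine lin_ext fun m n => lin_ext fun p s => ?_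
    simp only [LinearMap.compr₂_apply, LinearMap.flip_apply, LinearMap.compl₁₂_apply, bar, mulL,
      lin_mono, map_smul, LinearMap.smul_apply, smul_smul, ← qpow_add]
    congr 2
    · ring
    · ring
    · ring
  exact congrArg (fun L => L f g) h

/-- `star` on the quantum torus is the anti-involution `bar`; hence `Xᴴ` is the transpose of the
matrix obtained from `X` by applying `bar` to all entries. -/
instance (q : ℂˣ) : StarRing (QTorus q) where
  star := bar q
  star_involutive := bar_bar
  star_mul := bar_mul
  star_add := map_add (bar q)

lemma star_def {q : ℂˣ} (f : QTorus q) : star f = bar q f := rfl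

/-- `Λ(q) = {n ∈ ℤ | q ^ n = 1}`. -/
def Lam (q : ℂˣ) : Set ℤ := {n | q ^ n = 1}

/-! ### The Lie superalgebra `gl(1, 2N)(ℂ_q)` and its central extension -/

/-- The index set `{0} ⊔ {1, …, N} ⊔ {N + 1, …, 2N}`. -/
abbrev Ix (N : ℕ) : Type := Unit ⊕ (Fin N ⊕ Fin N)

/-- The index `0`. -/
def i0 (N : ℕ) : Ix N := Sum.inl ()

/-- The index `i`. -/
def iA {N : ℕ} (i : Fin N) : Ix N := Sum.inr (Sum.inl i)

/-- The index `N + i`. -/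
def iB {N : ℕ} (i : Fin N) : Ix N := Sum.inr (Sum.inr i)

/-- Parity of an index: `0` is even, the other `2N` indices are odd. -/
def par {N : ℕ} : Ix N → ZMod 2
  | Sum.inl _ => 0
  | Sum.inr _ => 1

/-- The underlying space of `gl(1, 2N)(ℂ_q)`. -/
abbrev Mat (N : ℕ) (q : ℂˣ) : Type := Matrix (Ix N) (Ix N) (QTorus q)

/-- The component of degree `α` of a matrix. -/
def part {N : ℕ} {q : ℂˣ} (α : ZMod 2) (X : Mat N q) : Mat N q :=
  Matrix.of fun i j => if par i + par j = α then X i j else 0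

/-- The sign `(-1) ^ (α β)`. -/
def sgn (α β : ZMod 2) : ℤ := if α = 1 ∧ β = 1 then -1 else 1

/-- The super-bracket of `gl(1, 2N)(ℂ_q)`: the bilinear extension of
`X Y - (-1) ^ (deg X deg Y) Y X`. -/
def sBracket {N : ℕ} {q : ℂˣ} (X Y : Mat N q) : Mat N q :=
  ∑ α : ZMod 2, ∑ β : ZMod 2,
    (part α X * part β Y - sgn α β • (part β Y * part α X))

/-- The scalar part of the `c(n)`-cocycle:
`(x ^ m y ^ n, x ^ p y ^ s) ↦ m q ^ (n p) c(n + s)` if `m + p = 0` and `n + s ∈ Λ(q)`, else `0`. -/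
def kap (q : ℂˣ) : QTorus q →ₗ[ℂ] QTorus q →ₗ[ℂ] (Lam q →₀ ℂ) :=
  open Classical in
  lin q fun m n => lin q fun p s =>
    if h : m + p = 0 ∧ n + s ∈ Lam q then
      Finsupp.single ⟨n + s, h.2⟩ ((m : ℂ) * qpow q (n * p)) else 0

/-- The scalar part of the `c_y`-cocycle:
`(x ^ m y ^ n, x ^ p y ^ s) ↦ n q ^ (n p)` if `m + p = 0` and `n + s = 0`, else `0`. -/
def kapY (q : ℂˣ) : QTorus q →ₗ[ℂ] QTorus q →ₗ[ℂ] ℂ :=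
  lin q fun m n => lin q fun p s =>
    if m + p = 0 ∧ n + s = 0 then (n : ℂ) * qpow q (n * p) else 0

/-- The underlying space of the central extension of `gl(1, 2N)(ℂ_q)`: a matrix, a combination of
the central elements `c(n)`, `n ∈ Λ(q)`, and a multiple of the central element `c_y`. -/
abbrev Hat (N : ℕ) (q : ℂˣ) : Type := Mat N q × (Lam q →₀ ℂ) × ℂ

/-- The sign of a diagonal entry in the super-trace. -/
def strSgn {N : ℕ} (i : Ix N) : ℤ := if par i = 0 then 1 else -1

/-- The bracket of the central extension. As `str(AB) = ∑ i, ∑ j, ± A i j * B j i`, the central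
terms are the signed sums of the scalar cocycles over pairs of opposite entries. -/
def hatBracket {N : ℕ} {q : ℂˣ} (x y : Hat N q) : Hat N q :=
  (sBracket x.1 y.1,
    ∑ i, ∑ j, strSgn i • kap q (x.1 i j) (y.1 j i),
    ∑ i, ∑ j, strSgn i • kapY q (x.1 i j) (y.1 j i))

/-- `x` is homogeneous of degree `α`; the centre is even. -/
def HatHomog {N : ℕ} {q : ℂˣ} (α : ZMod 2) (x : Hat N q) : Prop :=
  part α x.1 = x.1 ∧ (α = 1 → x.2 = 0)

/-! ### The superalgebras `S`, `[S, S]` and their central extensions -/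

/-- `J = diag(1, -I_{2N})`. -/
def Jmat (N : ℕ) (q : ℂˣ) : Mat N q :=
  Matrix.fromBlocks 1 0 0 (-1)

/-- `G = diag(1, [[0, I_N], [-I_N, 0]])`. -/
def Gmat (N : ℕ) (q : ℂˣ) : Mat N q :=
  Matrix.fromBlocks 1 0 0 (Matrix.fromBlocks 0 1 (-1) 0)

@[simp] lemma part_add {N : ℕ} {q : ℂˣ} (α : ZMod 2) (X Y : Mat N q) :
    part α (X + Y) = part α X + part α Y := by
  ext i j : 2
  simp only [part, Matrix.of_apply, Matrix.add_apply]
  split_ifs <;> simp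

@[simp] lemma part_zero {N : ℕ} {q : ℂˣ} (α : ZMod 2) : part α (0 : Mat N q) = 0 := by
  ext i j : 2
  simp [part]

@[simp] lemma part_smul {N : ℕ} {q : ℂˣ} (α : ZMod 2) (c : ℂ) (X : Mat N q) :
    part α (c • X) = c • part α X := by
  ext i j : 2
  simp only [part, Matrix.of_apply, Matrix.smul_apply]
  split_ifs <;> simp

lemma smul_mul_aux {q : ℂˣ} (c : ℂ) (f g : QTorus q) : (c • f) * g = c • (f * g) := by
  simp [mul_def]

lemma mul_smul_aux {q : ℂˣ} (c : ℂ) (f g : QTorus q) : f * (c • g) = c • (f * g) := by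
  simp [mul_def]

instance (q : ℂˣ) : IsScalarTower ℂ (QTorus q) (QTorus q) := ⟨fun c f g => smul_mul_aux c f g⟩

instance (q : ℂˣ) : SMulCommClass ℂ (QTorus q) (QTorus q) :=
  ⟨fun c f g => (mul_smul_aux c f g).symm⟩

lemma conjTranspose_csmul {N : ℕ} {q : ℂˣ} (c : ℂ) (X : Mat N q) : (c • X)ᴴ = c • Xᴴ := by
  ext i j : 2
  simp [Matrix.conjTranspose_apply, star_def]

/-- `S`: the even part of `X` satisfies `X̄ᵗ G + G X = 0`, and the odd part satisfies
`X̄ᵗ G - J G X = 0`. -/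
def SS (N : ℕ) (q : ℂˣ) : Submodule ℂ (Mat N q) where
  carrier := {X | (part 0 X)ᴴ * Gmat N q + Gmat N q * part 0 X = 0 ∧
    (part 1 X)ᴴ * Gmat N q - Jmat N q * Gmat N q * part 1 X = 0}
  add_mem' := by
    rintro X Y ⟨h1, h2⟩ ⟨h3, h4⟩
    constructor
    · rw [part_add, Matrix.conjTranspose_add, add_mul, mul_add, add_add_add_comm, h1, h3, add_zero]
    · rw [part_add, Matrix.conjTranspose_add, add_mul, mul_add, add_sub_add_comm, h2, h4, add_zero]
  zero_mem' := by simp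
  smul_mem' := by
    rintro c X ⟨h1, h2⟩
    constructor
    · rw [part_smul, conjTranspose_csmul, Matrix.smul_mul, Matrix.mul_smul, ← smul_add, h1,
        smul_zero]
    · rw [part_smul, conjTranspose_csmul, Matrix.smul_mul, Matrix.mul_smul, ← smul_sub, h2,
        smul_zero]

/-- `𝒢 = [S, S]`, the span of the super-brackets of elements of `S`. -/
def calG (N : ℕ) (q : ℂˣ) : Submodule ℂ (Mat N q) :=
  Submodule.span ℂ {Z | ∃ X ∈ SS N q, ∃ Y ∈ SS N q, Z = sBracket X Y}

/-- The central extension of `S`. -/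
def Shat (N : ℕ) (q : ℂˣ) : Submodule ℂ (Hat N q) := (SS N q).comap (LinearMap.fst ℂ _ _)

/-- The central extension of `𝒢 = [S, S]`. -/
def Ghat (N : ℕ) (q : ℂˣ) : Submodule ℂ (Hat N q) := (calG N q).comap (LinearMap.fst ℂ _ _)

lemma part_mul_part {N : ℕ} {q : ℂˣ} (α β : ZMod 2) (X Y : Mat N q) :
    part (α + β) (part α X * part β Y) = part α X * part β Y := by
  ext i j : 2
  simp only [part, Matrix.of_apply, Matrix.mul_apply]
  split_ifs with h
  · rfl
  · symm
    refine Finset.sum_eq_zero fun k _ => ?_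
    split_ifs with h1 h2
    · exact absurd (by rw [← h1, ← h2]; generalize par i = a; generalize par j = b;
                       generalize par k = c; revert a b c; decide) h
    all_goals simp

lemma part_mul_part_ne {N : ℕ} {q : ℂˣ} (α β γ : ZMod 2) (hγ : γ ≠ α + β) (X Y : Mat N q) :
    part γ (part α X * part β Y) = 0 := by
  rw [← part_mul_part]
  ext i j : 2
  simp only [part, Matrix.of_apply, Matrix.zero_apply]
  split_ifs with h h1
  · exact absurd (h.symm.trans h1) hγ
  all_goals rfl

@[simp] lemma part_sub {N : ℕ} {q : ℂˣ} (α : ZMod 2) (X Y : Mat N q) :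
    part α (X - Y) = part α X - part α Y := by
  ext i j : 2
  simp only [part, Matrix.of_apply, Matrix.sub_apply]
  split_ifs <;> simp

lemma sBracket_eq {N : ℕ} {q : ℂˣ} (X Y : Mat N q) :
    sBracket X Y = part 0 X * part 0 Y - part 0 Y * part 0 X
      + (part 0 X * part 1 Y - part 1 Y * part 0 X)
      + (part 1 X * part 0 Y - part 0 Y * part 1 X)
      + (part 1 X * part 1 Y + part 1 Y * part 1 X) := by
  have h (f : ZMod 2 → Mat N q) : ∑ α, f α = f 0 + f 1 := Fin.sum_univ_two f
  simp [sBracket, h, sgn, add_assoc]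

lemma part_zero_sBracket {N : ℕ} {q : ℂˣ} (X Y : Mat N q) :
    part 0 (sBracket X Y) = part 0 X * part 0 Y - part 0 Y * part 0 X
      + (part 1 X * part 1 Y + part 1 Y * part 1 X) := by
  have h00 := part_mul_part (0 : ZMod 2) 0 X Y
  have h00' := part_mul_part (0 : ZMod 2) 0 Y X
  have h11 := part_mul_part (1 : ZMod 2) 1 X Y
  have h11' := part_mul_part (1 : ZMod 2) 1 Y X
  rw [show (1 : ZMod 2) + 1 = 0 from rfl] at h11 h11'
  rw [show (0 : ZMod 2) + 0 = 0 from rfl] at h00 h00'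
  rw [sBracket_eq]
  simp only [part_add, part_sub, h00, h00', h11, h11',
    part_mul_part_ne 0 1 0 (by decide), part_mul_part_ne 1 0 0 (by decide)]
  simp

lemma part_one_sBracket {N : ℕ} {q : ℂˣ} (X Y : Mat N q) :
    part 1 (sBracket X Y) = part 0 X * part 1 Y - part 1 Y * part 0 X
      + (part 1 X * part 0 Y - part 0 Y * part 1 X) := by
  have h00 := part_mul_part (0 : ZMod 2) 1 X Y
  have h00' := part_mul_part (1 : ZMod 2) 0 Y X
  have h11 := part_mul_part (1 : ZMod 2) 0 X Y
  have h11' := part_mul_part (0 : ZMod 2) 1 Y X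
  rw [show (1 : ZMod 2) + 0 = 1 from rfl] at h11 h00'
  rw [show (0 : ZMod 2) + 1 = 1 from rfl] at h00 h11'
  rw [sBracket_eq]
  simp only [part_add, part_sub, h00, h00', h11, h11',
    part_mul_part_ne 0 0 1 (by decide), part_mul_part_ne 1 1 1 (by decide)]
  simp

lemma J_mul_odd {N : ℕ} {q : ℂˣ} (X : Mat N q) :
    (part 1 X)ᴴ * Jmat N q = - (Jmat N q * (part 1 X)ᴴ) := by
  have hJ : Jmat N q = Matrix.diagonal (Sum.elim (fun _ => 1) (fun _ => -1)) := by
    simp [Jmat, ← Matrix.fromBlocks_diagonal, ← Matrix.diagonal_neg]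
  rw [hJ]
  ext i j : 2
  rcases i with i | i <;> rcases j with j | j <;>
    simp [part, par, Matrix.conjTranspose_apply, Matrix.neg_apply,
      show (1 : ZMod 2) + 1 = 0 from rfl]

lemma J_mul_even' {N : ℕ} {q : ℂˣ} (X : Mat N q) :
    (part 0 X)ᴴ * Jmat N q = Jmat N q * (part 0 X)ᴴ := by
  have hJ : Jmat N q = Matrix.diagonal (Sum.elim (fun _ => 1) (fun _ => -1)) := by
    simp [Jmat, ← Matrix.fromBlocks_diagonal, ← Matrix.diagonal_neg]
  rw [hJ]
  ext i j : 2
  rcases i with i | i <;> rcases j with j | j <;>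
    simp [part, par, Matrix.conjTranspose_apply]

lemma J_mul_J (N : ℕ) (q : ℂˣ) : Jmat N q * Jmat N q = 1 := by
  simp [Jmat, Matrix.fromBlocks_multiply]

lemma sBracket_mem_SS {N : ℕ} {q : ℂˣ} {X Y : Mat N q} (hX : X ∈ SS N q) (hY : Y ∈ SS N q) :
    sBracket X Y ∈ SS N q := by
  obtain ⟨hX0, hX1⟩ := hX
  obtain ⟨hY0, hY1⟩ := hY
  have hX0 := eq_neg_of_add_eq_zero_left hX0
  have hY0 := eq_neg_of_add_eq_zero_left hY0
  have hX1 := sub_eq_zero.mp hX1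
  have hY1 := sub_eq_zero.mp hY1
  have eX := J_mul_even' X
  have eY := J_mul_even' Y
  have oX := J_mul_odd X
  have oY := J_mul_odd Y
  have JJ := J_mul_J N q
  constructor
  · rw [part_zero_sBracket]
    generalize part 0 X = X0 at *
    generalize part 1 X = X1 at *
    generalize part 0 Y = Y0 at *
    generalize part 1 Y = Y1 at *
    generalize Jmat N q = J at *
    generalize Gmat N q = G at *
    have e1 : Y0ᴴ * X0ᴴ * G = G * Y0 * X0 := by
      rw [mul_assoc, hX0, mul_neg, ← mul_assoc, hY0, neg_mul, neg_neg]
    have e2 : X0ᴴ * Y0ᴴ * G = G * X0 * Y0 := by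
      rw [mul_assoc, hY0, mul_neg, ← mul_assoc, hX0, neg_mul, neg_neg]
    have e3 : Y1ᴴ * X1ᴴ * G = - (G * Y1 * X1) := by
      rw [mul_assoc, hX1, ← mul_assoc, ← mul_assoc, oY, neg_mul, neg_mul, mul_assoc J, hY1,
        ← mul_assoc, ← mul_assoc, JJ, one_mul]
    have e4 : X1ᴴ * Y1ᴴ * G = - (G * X1 * Y1) := by
      rw [mul_assoc, hY1, ← mul_assoc, ← mul_assoc, oX, neg_mul, neg_mul, mul_assoc J, hX1,
        ← mul_assoc, ← mul_assoc, JJ, one_mul]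
    simp only [Matrix.conjTranspose_add, Matrix.conjTranspose_sub, Matrix.conjTranspose_mul,
      add_mul, sub_mul, mul_add, mul_sub, e1, e2, e3, e4, ← mul_assoc]
    abel
  · rw [part_one_sBracket]
    generalize part 0 X = X0 at *
    generalize part 1 X = X1 at *
    generalize part 0 Y = Y0 at *
    generalize part 1 Y = Y1 at *
    generalize Jmat N q = J at *
    generalize Gmat N q = G at *
    have e1 : Y1ᴴ * X0ᴴ * G = - (J * G * Y1 * X0) := by
      rw [mul_assoc, hX0, mul_neg, ← mul_assoc, hY1]
    have e2 : X0ᴴ * Y1ᴴ * G = - (J * G * X0 * Y1) := by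
      rw [mul_assoc, hY1, ← mul_assoc, ← mul_assoc, eX, mul_assoc J, hX0, mul_neg, neg_mul,
        ← mul_assoc]
    have e3 : X1ᴴ * Y0ᴴ * G = - (J * G * X1 * Y0) := by
      rw [mul_assoc, hY0, mul_neg, ← mul_assoc, hX1]
    have e4 : Y0ᴴ * X1ᴴ * G = - (J * G * Y0 * X1) := by
      rw [mul_assoc, hX1, ← mul_assoc, ← mul_assoc, eY, mul_assoc J, hY0, mul_neg, neg_mul,
        ← mul_assoc]
    simp only [Matrix.conjTranspose_add, Matrix.conjTranspose_sub, Matrix.conjTranspose_mul,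
      add_mul, sub_mul, mul_add, mul_sub, e1, e2, e3, e4, ← mul_assoc]
    abel

lemma calG_le_SS (N : ℕ) (q : ℂˣ) : calG N q ≤ SS N q := by
  refine Submodule.span_le.mpr ?_
  rintro _ ⟨X, hX, Y, hY, rfl⟩
  exact sBracket_mem_SS hX hY

lemma Ghat_le_Shat (N : ℕ) (q : ℂˣ) : Ghat N q ≤ Shat N q := fun _ hx => calG_le_SS N q hx

lemma Shat_closed (N : ℕ) (q : ℂˣ) :
    ∀ x ∈ Shat N q, ∀ y ∈ Shat N q, hatBracket x y ∈ Shat N q :=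
  fun _ hx _ hy => sBracket_mem_SS hx hy

lemma Ghat_closed (N : ℕ) (q : ℂˣ) :
    ∀ x ∈ Ghat N q, ∀ y ∈ Ghat N q, hatBracket x y ∈ Ghat N q :=
  fun x hx y hy => Submodule.subset_span
    ⟨x.1, calG_le_SS N q hx, y.1, calG_le_SS N q hy, rfl⟩

/-! ### The generators of `S` -/

lemma part_single {N : ℕ} {q : ℂˣ} (α : ZMod 2) (i j : Ix N) (f : QTorus q) :
    part α (Matrix.single i j f) = if par i + par j = α then Matrix.single i j f else 0 := by
  ext k l : 2
  by_cases h : i = k ∧ j = l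
  · obtain ⟨rfl, rfl⟩ := h
    simp only [part, Matrix.of_apply]
    split_ifs <;> simp
  · simp only [part, Matrix.of_apply]
    split_ifs <;> simp [Matrix.single_apply_of_ne _ _ _ _ _ h]

section
variable {N : ℕ} {q : ℂˣ} (i : Fin N) (r : Ix N) (f : QTorus q)

lemma mul_single_apply' (A : Mat N q) (a b k l : Ix N) :
    (A * Matrix.single a b f) k l = if b = l then A k a * f else 0 := by
  simp [Matrix.mul_apply, Matrix.single_apply, ite_and]

lemma single_mul_apply' (A : Mat N q) (a b k l : Ix N) :
    (Matrix.single a b f * A) k l = if a = k then f * A b l else 0 := by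
  simp [Matrix.mul_apply, Matrix.single_apply, ite_and]

lemma G_single_0 : Gmat N q * Matrix.single (i0 N) r f = Matrix.single (i0 N) r f := by
  ext k l : 2
  rw [mul_single_apply', Matrix.single_apply]
  rcases k with k | k | k <;> simp [Gmat, i0]

lemma G_single_A : Gmat N q * Matrix.single (iA i) r f = - Matrix.single (iB i) r f := by
  ext k l : 2
  rw [mul_single_apply', Matrix.neg_apply, Matrix.single_apply]
  rcases k with k | k | k <;>
    simp [Gmat, iA, iB, Matrix.one_apply] <;> split_ifs <;> simp_all

lemma G_single_B : Gmat N q * Matrix.single (iB i) r f = Matrix.single (iA i) r f := by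
  ext k l : 2
  rw [mul_single_apply', Matrix.single_apply]
  rcases k with k | k | k <;>
    simp [Gmat, iA, iB, Matrix.one_apply] <;> split_ifs <;> simp_all

lemma single_0_G : Matrix.single r (i0 N) f * Gmat N q = Matrix.single r (i0 N) f := by
  ext k l : 2
  rw [single_mul_apply', Matrix.single_apply]
  rcases l with l | l | l <;> simp [Gmat, i0]

lemma single_A_G : Matrix.single r (iA i) f * Gmat N q = Matrix.single r (iB i) f := by
  ext k l : 2
  rw [single_mul_apply', Matrix.single_apply]
  rcases l with l | l | l <;>
    simp [Gmat, iA, iB, Matrix.one_apply, ite_and]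

lemma single_B_G : Matrix.single r (iB i) f * Gmat N q = - Matrix.single r (iA i) f := by
  ext k l : 2
  rw [single_mul_apply', Matrix.neg_apply, Matrix.single_apply]
  rcases l with l | l | l <;>
    simp [Gmat, iA, iB, Matrix.one_apply] <;> split_ifs <;> simp_all

lemma J_single_0 : Jmat N q * Matrix.single (i0 N) r f = Matrix.single (i0 N) r f := by
  ext k l : 2
  rw [mul_single_apply', Matrix.single_apply]
  rcases k with k | k <;> simp [Jmat, i0]

lemma J_single_A : Jmat N q * Matrix.single (iA i) r f = - Matrix.single (iA i) r f := by
  ext k l : 2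
  rw [mul_single_apply', Matrix.neg_apply, Matrix.single_apply]
  rcases k with k | k | k <;>
    simp [Jmat, iA, Matrix.one_apply] <;> split_ifs <;> simp_all

lemma J_single_B : Jmat N q * Matrix.single (iB i) r f = - Matrix.single (iB i) r f := by
  ext k l : 2
  rw [mul_single_apply', Matrix.neg_apply, Matrix.single_apply]
  rcases k with k | k | k <;>
    simp [Jmat, iB, Matrix.one_apply] <;> split_ifs <;> simp_all

end

section
variable (N : ℕ) (q : ℂˣ)

/-- `g̃_ij(m, n) = x^m y^n e_{i, N+j} + bar(x^m y^n) e_{j, N+i}`. -/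
def gMat (i j : Fin N) (m n : ℤ) : Mat N q :=
  Matrix.single (iA i) (iB j) (mono q m n) + Matrix.single (iA j) (iB i) (bar q (mono q m n))

/-- `f̃_ij(m, n) = x^m y^n e_{ij} - bar(x^m y^n) e_{N+j, N+i}`. -/
def fMat (i j : Fin N) (m n : ℤ) : Mat N q :=
  Matrix.single (iA i) (iA j) (mono q m n) - Matrix.single (iB j) (iB i) (bar q (mono q m n))

/-- `h̃_ij(m, n) = -x^m y^n e_{N+i, j} - bar(x^m y^n) e_{N+j, i}`. -/
def hMat (i j : Fin N) (m n : ℤ) : Mat N q :=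
  - Matrix.single (iB i) (iA j) (mono q m n) - Matrix.single (iB j) (iA i) (bar q (mono q m n))

/-- `ẽ_i(m, n) = -x^m y^n e_{i, 0} - bar(x^m y^n) e_{0, N+i}`. -/
def eMat (i : Fin N) (m n : ℤ) : Mat N q :=
  - Matrix.single (iA i) (i0 N) (mono q m n) - Matrix.single (i0 N) (iB i) (bar q (mono q m n))

/-- `ẽ_i^*(m, n) = x^m y^n e_{N+i, 0} - bar(x^m y^n) e_{0, i}`. -/
def esMat (i : Fin N) (m n : ℤ) : Mat N q :=
  Matrix.single (iB i) (i0 N) (mono q m n) - Matrix.single (i0 N) (iA i) (bar q (mono q m n))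

/-- `ẽ_0(m, n) = -(x^m y^n - bar(x^m y^n)) e_{0, 0}`. -/
def e0Mat (m n : ℤ) : Mat N q :=
  - Matrix.single (i0 N) (i0 N) (mono q m n - bar q (mono q m n))

variable {N q}

lemma par_i0 : par (i0 N) = 0 := rfl
lemma par_iA (i : Fin N) : par (iA i) = 1 := rfl
lemma par_iB (i : Fin N) : par (iB i) = 1 := rfl

lemma part_neg (α : ZMod 2) (X : Mat N q) : part α (-X) = - part α X := by
  rw [← zero_sub, part_sub, part_zero, zero_sub]

lemma gMat_mem (i j : Fin N) (m n : ℤ) : gMat N q i j m n ∈ SS N q := by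
  constructor <;>
  · simp [gMat, part_single, par_iA, par_iB, show (1 : ZMod 2) + 1 = 0 from rfl, star_def, bar_bar,
      add_mul, mul_add, single_A_G, single_B_G, G_single_A, G_single_B]

lemma fMat_mem (i j : Fin N) (m n : ℤ) : fMat N q i j m n ∈ SS N q := by
  constructor <;>
  · simp [fMat, part_single, par_iA, par_iB, show (1 : ZMod 2) + 1 = 0 from rfl, star_def, bar_bar,
      sub_mul, mul_sub, single_A_G, single_B_G, G_single_A, G_single_B]
    try abel

lemma hMat_mem (i j : Fin N) (m n : ℤ) : hMat N q i j m n ∈ SS N q := by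
  constructor <;>
  · simp [hMat, part_single, part_neg, par_iA, par_iB, show (1 : ZMod 2) + 1 = 0 from rfl, star_def,
      bar_bar, sub_mul, mul_sub, single_A_G, single_B_G, G_single_A, G_single_B]
    try abel

lemma eMat_mem (i : Fin N) (m n : ℤ) : eMat N q i m n ∈ SS N q := by
  constructor <;>
  · simp [eMat, part_single, part_neg, par_iA, par_iB, par_i0, star_def,
      bar_bar, sub_mul, mul_sub, single_A_G, single_B_G, G_single_A, G_single_B, single_0_G,
      G_single_0, mul_assoc, J_single_0, J_single_A, J_single_B]
    try abel

lemma esMat_mem (i : Fin N) (m n : ℤ) : esMat N q i m n ∈ SS N q := by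
  constructor <;>
  · simp [esMat, part_single, part_neg, par_iA, par_iB, par_i0, star_def,
      bar_bar, sub_mul, mul_sub, single_A_G, single_B_G, G_single_A, G_single_B, single_0_G,
      G_single_0, mul_assoc, J_single_0, J_single_A, J_single_B]
    try abel

lemma e0Mat_mem (m n : ℤ) : e0Mat N q m n ∈ SS N q := by
  constructor <;>
  · simp only [e0Mat, part_neg, part_single, par_i0]
    simp [star_def, bar_bar, single_0_G, G_single_0, ← neg_add, ← Matrix.single_add]

variable (N q)

/-- `g̃_ij(m, n)` as an element of the central extension of `S`. -/
def gT (i j : Fin N) (m n : ℤ) : Shat N q := ⟨(gMat N q i j m n, 0), gMat_mem i j m n⟩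

/-- `f̃_ij(m, n)` as an element of the central extension of `S`. -/
def fT (i j : Fin N) (m n : ℤ) : Shat N q := ⟨(fMat N q i j m n, 0), fMat_mem i j m n⟩

/-- `h̃_ij(m, n)` as an element of the central extension of `S`. -/
def hT (i j : Fin N) (m n : ℤ) : Shat N q := ⟨(hMat N q i j m n, 0), hMat_mem i j m n⟩

/-- `ẽ_i(m, n)` as an element of the central extension of `S`. -/
def eT (i : Fin N) (m n : ℤ) : Shat N q := ⟨(eMat N q i m n, 0), eMat_mem i m n⟩

/-- `ẽ_i^*(m, n)` as an element of the central extension of `S`. -/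
def esT (i : Fin N) (m n : ℤ) : Shat N q := ⟨(esMat N q i m n, 0), esMat_mem i m n⟩

/-- `ẽ_0(m, n)` as an element of the central extension of `S`. -/
def e0T (m n : ℤ) : Shat N q := ⟨(e0Mat N q m n, 0), e0Mat_mem m n⟩

/-- The central element `c(n)`, `n ∈ Λ(q)`. -/
def cT (n : Lam q) : Shat N q := ⟨(0, Finsupp.single n 1, 0), (SS N q).zero_mem⟩

/-- The central element `c_y`. -/
def cyT : Shat N q := ⟨(0, 0, 1), (SS N q).zero_mem⟩

end

/-! ### The algebra of bosons and fermions and its Fock space -/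

/-- The generators `a_i(m)`, `a_i^*(m)`, `e(m)`. -/
inductive Gen (N : ℕ) : Type
  | a (i : Fin N) (m : ℤ)
  | as (i : Fin N) (m : ℤ)
  | e (m : ℤ)

open FreeAlgebra in
/-- The defining relations of `α_τ(N)`: `[a_i(m), a_j(n)] = [a_i^*(m), a_j^*(n)] = 0`,
`[a_i(m), a_j^*(n)] = -δ_ij δ_{m+n,0}`, `{e(m), e(n)}_+ = -δ_{m+n,0}`, and
`a_i(m) e(n) + τ e(n) a_i(m) = 0 = a_i^*(m) e(n) + τ e(n) a_i^*(m)`. -/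
inductive AlgRel (N : ℕ) (τ : ℤˣ) : FreeAlgebra ℂ (Gen N) → FreeAlgebra ℂ (Gen N) → Prop
  | aa (i j : Fin N) (m n : ℤ) :
      AlgRel N τ (ι ℂ (Gen.a i m) * ι ℂ (Gen.a j n) - ι ℂ (Gen.a j n) * ι ℂ (Gen.a i m)) 0
  | ss (i j : Fin N) (m n : ℤ) :
      AlgRel N τ (ι ℂ (Gen.as i m) * ι ℂ (Gen.as j n) - ι ℂ (Gen.as j n) * ι ℂ (Gen.as i m)) 0
  | as (i j : Fin N) (m n : ℤ) :
      AlgRel N τ (ι ℂ (Gen.a i m) * ι ℂ (Gen.as j n) - ι ℂ (Gen.as j n) * ι ℂ (Gen.a i m))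
        (if i = j ∧ m + n = 0 then -1 else 0)
  | ee (m n : ℤ) :
      AlgRel N τ (ι ℂ (Gen.e m) * ι ℂ (Gen.e n) + ι ℂ (Gen.e n) * ι ℂ (Gen.e m))
        (if m + n = 0 then -1 else 0)
  | ae (i : Fin N) (m n : ℤ) :
      AlgRel N τ (ι ℂ (Gen.a i m) * ι ℂ (Gen.e n)
        + ((τ : ℤ) : ℂ) • (ι ℂ (Gen.e n) * ι ℂ (Gen.a i m))) 0
  | se (i : Fin N) (m n : ℤ) :
      AlgRel N τ (ι ℂ (Gen.as i m) * ι ℂ (Gen.e n)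
        + ((τ : ℤ) : ℂ) • (ι ℂ (Gen.e n) * ι ℂ (Gen.as i m))) 0

/-- The algebra `α_τ(N)`. -/
abbrev Alg (N : ℕ) (τ : ℤˣ) : Type := RingQuot (AlgRel N τ)

/-- A generator of `α_τ(N)`. -/
def gen {N : ℕ} (τ : ℤˣ) (x : Gen N) : Alg N τ :=
  RingQuot.mkAlgHom ℂ (AlgRel N τ) (FreeAlgebra.ι ℂ x)

/-- The simple bosonic module `V(N, -)`, realised as the polynomial algebra on the creation
operators: the variable `(i, k)` is `a_i(k)` if `k ≤ 0`, and `a_i^*(-k)` if `k > 0`. The vacuum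
vector is `1`. -/
abbrev Bos (N : ℕ) : Type := MvPolynomial (Fin N × ℤ) ℂ

/-- The action of `a_i(m)` on `V(N, -)`: creation for `m ≤ 0`, annihilation for `m > 0`. -/
def bosA {N : ℕ} (i : Fin N) (m : ℤ) : Module.End ℂ (Bos N) :=
  if m ≤ 0 then LinearMap.mulLeft ℂ (MvPolynomial.X (i, m))
  else - (MvPolynomial.pderiv (i, m)).toLinearMap

/-- The action of `a_i^*(m)` on `V(N, -)`: creation for `m < 0`, annihilation for `m ≥ 0`. -/
def bosAs {N : ℕ} (i : Fin N) (m : ℤ) : Module.End ℂ (Bos N) :=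
  if m < 0 then LinearMap.mulLeft ℂ (MvPolynomial.X (i, -m))
  else (MvPolynomial.pderiv (i, -m)).toLinearMap

/-- The operator on `V(N, -)` that multiplies polynomials of degree `d` by `(-τ) ^ d`. -/
def twist (N : ℕ) (τ : ℤˣ) : Module.End ℂ (Bos N) :=
  (MvPolynomial.aeval fun x => (-((τ : ℤ) : ℂ)) • (MvPolynomial.X x : Bos N)).toLinearMap

/-- The simple Clifford module `V_0`, realised as the exterior algebra on the creation operators:
the `k`-th basis vector of `ℕ →₀ ℂ` is `e(-(k + 1))`. The vacuum vector is `1`. -/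
abbrev Fer : Type := ExteriorAlgebra ℂ (ℕ →₀ ℂ)

/-- The action of `e(m)` on `V_0`: exterior multiplication for `m < 0`, minus contraction for
`m > 0`; `e(0)` acts on the vacuum vector as the scalar `lam` (with `lam ^ 2 = -1/2`), and hence on
the `d`-th exterior power as `(-1) ^ d lam`. -/
def ferE (lam : ℂ) : ℤ → Module.End ℂ Fer
  | Int.ofNat 0 => lam • (CliffordAlgebra.involute (Q := (0 : QuadraticForm ℂ (ℕ →₀ ℂ)))).toLinearMap
  | Int.ofNat (k + 1) =>
      - CliffordAlgebra.contractLeft (Q := (0 : QuadraticForm ℂ (ℕ →₀ ℂ))) (Finsupp.lapply k)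
  | Int.negSucc k => LinearMap.mulLeft ℂ (ExteriorAlgebra.ι ℂ (Finsupp.single k 1))

/-- The underlying space of `V_τ(N) = V(N, -) ⊗ V_0`. -/
abbrev Fock (N : ℕ) : Type := Bos N ⊗[ℂ] Fer

/-- The action of the generators on `V_τ(N)`; the first factor in the action of `e(m)` makes it
satisfy `a_i(n) e(m) + τ e(m) a_i(n) = 0`. -/
def genAct (N : ℕ) (τ : ℤˣ) (lam : ℂ) : Gen N → Module.End ℂ (Fock N)
  | Gen.a i m => TensorProduct.map (bosA i m) LinearMap.id
  | Gen.as i m => TensorProduct.map (bosAs i m) LinearMap.id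
  | Gen.e m => TensorProduct.map (twist N τ) (ferE lam m)

lemma pd_pd {N : ℕ} (x y : Fin N × ℤ) (p : Bos N) :
    MvPolynomial.pderiv x (MvPolynomial.pderiv y p)
      = MvPolynomial.pderiv y (MvPolynomial.pderiv x p) := by
  have h : ⁅(MvPolynomial.pderiv x : Derivation ℂ (Bos N) (Bos N)),
      (MvPolynomial.pderiv y : Derivation ℂ (Bos N) (Bos N))⁆ = 0 := by
    classical
    refine MvPolynomial.derivation_ext fun z => ?_
    simp [Derivation.commutator_apply, MvPolynomial.pderiv_X, Pi.single_apply, apply_ite]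
  have h' := congrArg (fun D : Derivation ℂ (Bos N) (Bos N) => D p) h
  exact sub_eq_zero.mp (by simpa [Derivation.commutator_apply] using h')

lemma bosA_comm {N : ℕ} (i j : Fin N) (m n : ℤ) : bosA i m * bosA j n = bosA j n * bosA i m := by
  refine LinearMap.ext fun p => ?_
  unfold bosA
  split_ifs with h1 h2 h2
  · simp [mul_left_comm]
  · have : (j, n) ≠ (i, m) := by rintro ⟨⟩; omega
    simp [Derivation.leibniz, MvPolynomial.pderiv_X_of_ne this.symm]
  · have : (i, m) ≠ (j, n) := by rintro ⟨⟩; omega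
    simp [Derivation.leibniz, MvPolynomial.pderiv_X_of_ne this.symm]
  · simp [pd_pd (i, m)]

lemma bosAs_comm {N : ℕ} (i j : Fin N) (m n : ℤ) :
    bosAs i m * bosAs j n = bosAs j n * bosAs i m := by
  refine LinearMap.ext fun p => ?_
  unfold bosAs
  split_ifs with h1 h2 h2
  · simp [mul_left_comm]
  · have : (j, -n) ≠ (i, -m) := by
      intro h
      have := (Prod.mk.inj h).2
      omega
    simp [Derivation.leibniz, MvPolynomial.pderiv_X_of_ne this.symm]
  · have : (i, -m) ≠ (j, -n) := by
      intro h
      have := (Prod.mk.inj h).2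
      omega
    simp [Derivation.leibniz, MvPolynomial.pderiv_X_of_ne this.symm]
  · simp [pd_pd (i, -m)]

lemma bosA_bosAs {N : ℕ} (i j : Fin N) (m n : ℤ) :
    bosA i m * bosAs j n =
      (if i = j ∧ m + n = 0 then (-1 : ℂ) else 0) • (1 : Module.End ℂ (Bos N))
        + bosAs j n * bosA i m := by
  refine LinearMap.ext fun p => ?_
  by_cases h : i = j ∧ m + n = 0
  · obtain ⟨rfl, h⟩ := h
    obtain rfl : n = -m := by omega
    unfold bosA bosAs
    rcases le_or_gt m 0 with hm | hm
    · have h1 : ¬ (-m < 0) := by omega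
      simp only [if_pos hm, if_neg h1]
      simp [Derivation.leibniz]
    · have h1 : -m < 0 := by omega
      have h2 : ¬ (m ≤ 0) := by omega
      simp only [if_neg h2, if_pos h1]
      simp [Derivation.leibniz]
  · rw [if_neg h]
    unfold bosA bosAs
    have hne : (i, m) ≠ (j, -n) := by
      intro h'
      have h1 := (Prod.mk.inj h')
      exact h ⟨h1.1, by omega⟩
    split_ifs with h1 h2 h2
    · simp [mul_left_comm]
    · simp [Derivation.leibniz, MvPolynomial.pderiv_X_of_ne hne]
    · simp [Derivation.leibniz, MvPolynomial.pderiv_X_of_ne hne.symm]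
    · simp [pd_pd (i, m)]

lemma tau_sq (τ : ℤˣ) : ((τ : ℤ) : ℂ) * ((τ : ℤ) : ℂ) = 1 := by
  rcases Int.units_eq_one_or τ with rfl | rfl <;> simp

lemma mulX_twist {N : ℕ} (τ : ℤˣ) (x : Fin N × ℤ) (p : Bos N) :
    MvPolynomial.X x * twist N τ p = (-((τ : ℤ) : ℂ)) • twist N τ (MvPolynomial.X x * p) := by
  simp [twist, smul_smul, tau_sq]

lemma pd_twist {N : ℕ} (τ : ℤˣ) (x : Fin N × ℤ) (p : Bos N) :
    MvPolynomial.pderiv x (twist N τ p)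
      = (-((τ : ℤ) : ℂ)) • twist N τ (MvPolynomial.pderiv x p) := by
  classical
  induction p using MvPolynomial.induction_on with
  | C c => simp [twist]
  | add p p' hp hp' => simp only [map_add, hp, hp', smul_add]
  | mul_X p y hp =>
    have hmul (f g : Bos N) : twist N τ (f * g) = twist N τ f * twist N τ g := by simp [twist]
    have hX : twist N τ (MvPolynomial.X y) = (-((τ : ℤ) : ℂ)) • MvPolynomial.X y := by simp [twist]
    rw [hmul, hX, Derivation.leibniz, Derivation.leibniz, hp]
    by_cases hxy : y = x
    · subst hxy
      simp [hmul, hX, smul_smul, tau_sq, mul_comm]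
    · simp [MvPolynomial.pderiv_X_of_ne hxy, hmul, hX, mul_comm]

lemma bosA_twist {N : ℕ} (τ : ℤˣ) (i : Fin N) (m : ℤ) :
    bosA i m * twist N τ = (-((τ : ℤ) : ℂ)) • (twist N τ * bosA i m) := by
  refine LinearMap.ext fun p => ?_
  unfold bosA
  split_ifs
  · exact mulX_twist τ _ p
  · exact (congrArg Neg.neg (pd_twist τ (i, m) p)).trans (by simp)

lemma bosAs_twist {N : ℕ} (τ : ℤˣ) (i : Fin N) (m : ℤ) :
    bosAs i m * twist N τ = (-((τ : ℤ) : ℂ)) • (twist N τ * bosAs i m) := by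
  refine LinearMap.ext fun p => ?_
  unfold bosAs
  split_ifs
  · exact mulX_twist τ _ p
  · exact pd_twist τ _ p

lemma twist_twist (N : ℕ) (τ : ℤˣ) : twist N τ * twist N τ = 1 := by
  have h : (MvPolynomial.aeval fun x => (-((τ : ℤ) : ℂ)) • (MvPolynomial.X x : Bos N)).comp
      (MvPolynomial.aeval fun x => (-((τ : ℤ) : ℂ)) • (MvPolynomial.X x : Bos N))
      = AlgHom.id ℂ (Bos N) := by
    refine MvPolynomial.algHom_ext fun x => ?_
    simp [smul_smul, tau_sq]
  exact LinearMap.ext fun p => congrArg (fun φ : Bos N →ₐ[ℂ] Bos N => φ p) h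

section
open CliffordAlgebra

lemma contract_involute (d : Module.Dual ℂ (ℕ →₀ ℂ)) (x : Fer) :
    contractLeft (Q := (0 : QuadraticForm ℂ (ℕ →₀ ℂ))) d
        (involute (Q := (0 : QuadraticForm ℂ (ℕ →₀ ℂ))) x)
      = - involute (Q := (0 : QuadraticForm ℂ (ℕ →₀ ℂ)))
          (contractLeft (Q := (0 : QuadraticForm ℂ (ℕ →₀ ℂ))) d x) := by
  induction x using CliffordAlgebra.left_induction with
  | algebraMap r => simp
  | add x y hx hy => simp only [map_add, hx, hy, neg_add]
  | ι_mul x v hx =>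
    simp only [map_mul, involute_ι, neg_mul, map_neg, contractLeft_ι_mul, hx, map_sub, map_smul]
    simp [sub_eq_add_neg, add_comm]

lemma ferE_ferE {lam : ℂ} (hlam : lam ^ 2 = -1 / 2) (m n : ℤ) :
    ferE lam m * ferE lam n + ferE lam n * ferE lam m =
      (if m + n = 0 then (-1 : ℂ) else 0) • (1 : Module.End ℂ Fer) := by
  refine LinearMap.ext fun x => ?_
  have swap (v w : ℕ →₀ ℂ) : ExteriorAlgebra.ι ℂ v * (ExteriorAlgebra.ι ℂ w * x)
      + ExteriorAlgebra.ι ℂ w * (ExteriorAlgebra.ι ℂ v * x) = 0 := by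
    rw [← mul_assoc, ← mul_assoc, ← add_mul, ExteriorAlgebra.ι_add_mul_swap, zero_mul]
  have ct (k l : ℕ) (y : Fer) : contractLeft (Q := (0 : QuadraticForm ℂ (ℕ →₀ ℂ)))
      (Finsupp.lapply k) (ExteriorAlgebra.ι ℂ (Finsupp.single l 1) * y)
      = (if l = k then (1 : ℂ) else 0) • y - ExteriorAlgebra.ι ℂ (Finsupp.single l 1) *
        contractLeft (Q := (0 : QuadraticForm ℂ (ℕ →₀ ℂ))) (Finsupp.lapply k) y := by
    refine (contractLeft_ι_mul _ _ _).trans ?_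
    rw [Finsupp.lapply_apply, Finsupp.single_apply]
  have iv (v : ℕ →₀ ℂ) (y : Fer) : involute (Q := (0 : QuadraticForm ℂ (ℕ →₀ ℂ)))
      (ExteriorAlgebra.ι ℂ v * y) = - (ExteriorAlgebra.ι ℂ v *
        involute (Q := (0 : QuadraticForm ℂ (ℕ →₀ ℂ))) y) := by
    refine (map_mul _ _ _).trans ?_
    rw [← neg_mul]
    congr 1
    exact involute_ι v
  have cc (d d' : Module.Dual ℂ (ℕ →₀ ℂ)) :
      contractLeft (Q := (0 : QuadraticForm ℂ (ℕ →₀ ℂ))) d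
        (contractLeft (Q := (0 : QuadraticForm ℂ (ℕ →₀ ℂ))) d' x)
      = - contractLeft (Q := (0 : QuadraticForm ℂ (ℕ →₀ ℂ))) d'
        (contractLeft (Q := (0 : QuadraticForm ℂ (ℕ →₀ ℂ))) d x) :=
    contractLeft_comm d d' x
  match m, n with
  | Int.ofNat 0, Int.ofNat 0 =>
    simp only [ferE, LinearMap.add_apply, Module.End.mul_apply, LinearMap.smul_apply, map_smul,
      AlgHom.toLinearMap_apply, involute_involute, smul_smul, ← add_smul]
    simp [← pow_two, hlam]
  | Int.ofNat 0, Int.ofNat (k + 1) =>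
    have h : ¬ ((Int.ofNat 0) + Int.ofNat (k + 1) = 0) := by simp; omega
    rw [if_neg h]
    simp [ferE, contract_involute]
  | Int.ofNat (k + 1), Int.ofNat 0 =>
    have h : ¬ (Int.ofNat (k + 1) + (Int.ofNat 0) = 0) := by simp; omega
    rw [if_neg h]
    simp [ferE, contract_involute]
  | Int.ofNat 0, Int.negSucc k =>
    have h : ¬ ((Int.ofNat 0) + Int.negSucc k = 0) := by simp
    rw [if_neg h]
    simp [ferE, iv]
  | Int.negSucc k, Int.ofNat 0 =>
    have h : ¬ (Int.negSucc k + (Int.ofNat 0) = 0) := by simp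
    rw [if_neg h]
    simp [ferE, iv]
  | Int.ofNat (k + 1), Int.ofNat (l + 1) =>
    have h : ¬ (Int.ofNat (k + 1) + Int.ofNat (l + 1) = 0) := by simp; omega
    rw [if_neg h]
    simp [ferE, cc (Finsupp.lapply k) (Finsupp.lapply l)]
  | Int.negSucc k, Int.negSucc l =>
    have h : ¬ (Int.negSucc k + Int.negSucc l = 0) := by omega
    rw [if_neg h]
    simpa [ferE] using swap _ _
  | Int.ofNat (k + 1), Int.negSucc l =>
    have h : (Int.ofNat (k + 1) + Int.negSucc l = 0) ↔ l = k := by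
      simp only [Int.ofNat_eq_natCast]; omega
    simp only [h]
    simp only [ferE, LinearMap.add_apply, Module.End.mul_apply, LinearMap.neg_apply,
      LinearMap.mulLeft_apply, ct, mul_neg]
    rw [LinearMap.smul_apply, Module.End.one_apply]
    split_ifs <;> simp only [one_smul, zero_smul, neg_smul] <;> abel
  | Int.negSucc l, Int.ofNat (k + 1) =>
    have h : (Int.negSucc l + Int.ofNat (k + 1) = 0) ↔ l = k := by
      simp only [Int.ofNat_eq_natCast]; omega
    simp only [h]
    simp only [ferE, LinearMap.add_apply, Module.End.mul_apply, LinearMap.neg_apply,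
      LinearMap.mulLeft_apply, ct, mul_neg]
    rw [LinearMap.smul_apply, Module.End.one_apply]
    split_ifs <;> simp only [one_smul, zero_smul, neg_smul] <;> abel

end

lemma genAct_rel {N : ℕ} {τ : ℤˣ} {lam : ℂ} (hlam : lam ^ 2 = -1 / 2)
    ⦃x y : FreeAlgebra ℂ (Gen N)⦄ (h : AlgRel N τ x y) :
    FreeAlgebra.lift ℂ (genAct N τ lam) x = FreeAlgebra.lift ℂ (genAct N τ lam) y := by
  have tmul (f f' : Module.End ℂ (Bos N)) (g g' : Module.End ℂ Fer) :
      (TensorProduct.map f g * TensorProduct.map f' g' : Module.End ℂ (Fock N))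
        = TensorProduct.map (f * f') (g * g') := (TensorProduct.map_mul f f' g g').symm
  have t1 : (TensorProduct.map 1 1 : Module.End ℂ (Fock N)) = 1 := TensorProduct.map_one
  have id1 : (LinearMap.id : Module.End ℂ Fer) = 1 := rfl
  have hite (P : Prop) [Decidable P] : FreeAlgebra.lift ℂ (genAct N τ lam) (if P then -1 else 0)
      = (if P then (-1 : ℂ) else 0) • (1 : Module.End ℂ (Fock N)) := by
    split_ifs
    · rw [map_neg, map_one]
      exact (neg_one_smul ℂ (1 : Module.End ℂ (Fock N))).symm
    · rw [map_zero, zero_smul]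
  induction h with
  | aa i j m n => simp [genAct, tmul, bosA_comm i j m n]
  | ss i j m n => simp [genAct, tmul, bosAs_comm i j m n]
  | as i j m n =>
    simp only [map_sub, map_mul, FreeAlgebra.lift_ι_apply, genAct, tmul]
    rw [bosA_bosAs i j m n, TensorProduct.map_add_left, hite, TensorProduct.map_smul_left, id1,
      one_mul, t1]
    exact add_sub_cancel_right (G := Module.End ℂ (Fock N)) _ _
  | ee m n =>
    simp only [map_add, map_mul, FreeAlgebra.lift_ι_apply, genAct, tmul, twist_twist]
    rw [← TensorProduct.map_add_right, ferE_ferE hlam, TensorProduct.map_smul_right, t1,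
      hite]
  | ae i m n =>
    simp only [map_add, map_smul, map_mul, FreeAlgebra.lift_ι_apply, genAct, tmul, map_zero]
    rw [bosA_twist, TensorProduct.map_smul_left, id1, one_mul, mul_one, ← add_smul,
      neg_add_cancel, zero_smul]
  | se i m n =>
    simp only [map_add, map_smul, map_mul, FreeAlgebra.lift_ι_apply, genAct, tmul, map_zero]
    rw [bosAs_twist, TensorProduct.map_smul_left, id1, one_mul, mul_one, ← add_smul,
      neg_add_cancel, zero_smul]

/-- The action of `α_τ(N)` on `V_τ(N)`. -/
def fockRep (N : ℕ) (τ : ℤˣ) (lam : ℂ) (hlam : lam ^ 2 = -1 / 2) :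
    Alg N τ →ₐ[ℂ] Module.End ℂ (Fock N) :=
  RingQuot.liftAlgHom ℂ ⟨FreeAlgebra.lift ℂ (genAct N τ lam), genAct_rel hlam⟩

/-! ### Normal ordering and the operators on the Fock space -/

/-- The normally ordered product `:u(m) v(n):`, with `ε = 1` for two bosons and `ε = -1` for two
fermions. -/
def nord {A : Type*} [Ring A] [Algebra ℂ A] (ε : ℤ) (u v : ℤ → A) (m n : ℤ) : A :=
  if m < n then u m * v n
  else if m = n then (1 / 2 : ℂ) • (u m * v n + ε • (v n * u m))
  else ε • (v n * u m)

/-- Local finiteness of a family of operators: every vector is killed by all but finitely many. -/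
def LocFin {V : Type*} [AddCommGroup V] [Module ℂ V] (t : ℤ → Module.End ℂ V) : Prop :=
  ∀ v, (Function.support fun s => t s v).Finite

open Classical in
/-- The sum `v ↦ ∑ s, t s v` of a locally finite family of operators (`0` if the family is not
locally finite). -/
def locSum {V : Type*} [AddCommGroup V] [Module ℂ V] (t : ℤ → Module.End ℂ V) :
    Module.End ℂ V :=
  if h : LocFin t then
    { toFun := fun v => ∑ᶠ s, t s v
      map_add' := fun v w => by
        simp only [map_add]
        exact finsum_add_distrib (h v) (h w)
      map_smul' := fun c v => by
        simp only [map_smul, RingHom.id_apply]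
        exact (smul_finsum' c (h v)).symm }
  else 0

section
variable (N : ℕ) (q : ℂˣ) (τ : ℤˣ) (lam : ℂ) (hlam : lam ^ 2 = -1 / 2)

/-- The `s`-th term `q^(-ns) :a_i(m-s) a_j^*(s):` of `f_ij(m, n)`. -/
def fTerm (i j : Fin N) (m n s : ℤ) : Module.End ℂ (Fock N) :=
  qpow q (-(n * s)) • fockRep N τ lam hlam
    (nord 1 (fun k => gen τ (Gen.a i k)) (fun k => gen τ (Gen.as j k)) (m - s) s)

/-- The `s`-th term `q^(-ns) :a_i(m-s) a_j(s):` of `g_ij(m, n)`. -/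
def gTerm (i j : Fin N) (m n s : ℤ) : Module.End ℂ (Fock N) :=
  qpow q (-(n * s)) • fockRep N τ lam hlam
    (nord 1 (fun k => gen τ (Gen.a i k)) (fun k => gen τ (Gen.a j k)) (m - s) s)

/-- The `s`-th term `q^(-ns) :a_i^*(m-s) a_j^*(s):` of `h_ij(m, n)`. -/
def hTerm (i j : Fin N) (m n s : ℤ) : Module.End ℂ (Fock N) :=
  qpow q (-(n * s)) • fockRep N τ lam hlam
    (nord 1 (fun k => gen τ (Gen.as i k)) (fun k => gen τ (Gen.as j k)) (m - s) s)

/-- The `s`-th term `q^(-ns) :a_i(m-s) e(s): = q^(-ns) a_i(m-s) e(s)` of `e_i(m, n)`. -/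
def eTerm (i : Fin N) (m n s : ℤ) : Module.End ℂ (Fock N) :=
  qpow q (-(n * s)) • fockRep N τ lam hlam (gen τ (Gen.a i (m - s)) * gen τ (Gen.e s))

/-- The `s`-th term `q^(-ns) :a_i^*(m-s) e(s): = q^(-ns) a_i^*(m-s) e(s)` of `e_i^*(m, n)`. -/
def esTerm (i : Fin N) (m n s : ℤ) : Module.End ℂ (Fock N) :=
  qpow q (-(n * s)) • fockRep N τ lam hlam (gen τ (Gen.as i (m - s)) * gen τ (Gen.e s))

/-- The `s`-th term `q^(-ns) :e(m-s) e(s):` of `e_0(m, n)`. -/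
def e0Term (m n s : ℤ) : Module.End ℂ (Fock N) :=
  qpow q (-(n * s)) • fockRep N τ lam hlam
    (nord (-1) (fun k => gen τ (Gen.e k)) (fun k => gen τ (Gen.e k)) (m - s) s)

open Classical in
/-- The central shift: `0` for `n ∈ Λ(q)`, and `(1/2) δ_{m,0} (q^n + 1) / (q^n - 1)` otherwise. -/
def shift (m n : ℤ) : ℂ :=
  if n ∈ Lam q then 0 else if m = 0 then 1 / 2 * ((qpow q n + 1) / (qpow q n - 1)) else 0

/-- `F_ij(m, n)`. -/
def opF (i j : Fin N) (m n : ℤ) : Module.End ℂ (Fock N) :=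
  locSum (fTerm N q τ lam hlam i j m n) + (if i = j then shift q m n else 0) • 1

/-- `G_ij(m, n) = g_ij(m, n)`. -/
def opG (i j : Fin N) (m n : ℤ) : Module.End ℂ (Fock N) := locSum (gTerm N q τ lam hlam i j m n)

/-- `H_ij(m, n) = h_ij(m, n)`. -/
def opH (i j : Fin N) (m n : ℤ) : Module.End ℂ (Fock N) := locSum (hTerm N q τ lam hlam i j m n)

/-- `E_i(m, n) = e_i(m, n)`. -/
def opE (i : Fin N) (m n : ℤ) : Module.End ℂ (Fock N) := locSum (eTerm N q τ lam hlam i m n)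

/-- `E_i^*(m, n) = e_i^*(m, n)`. -/
def opEs (i : Fin N) (m n : ℤ) : Module.End ℂ (Fock N) := locSum (esTerm N q τ lam hlam i m n)

/-- `E_0(m, n)`. -/
def opE0 (m n : ℤ) : Module.End ℂ (Fock N) :=
  locSum (e0Term N q τ lam hlam m n) + shift q m n • 1

/-- All the sums that define the operators on `V_τ(N)` are locally finite. -/
def AllLocFin : Prop :=
  (∀ i j m n, LocFin (fTerm N q τ lam hlam i j m n)) ∧
  (∀ i j m n, LocFin (gTerm N q τ lam hlam i j m n)) ∧
  (∀ i j m n, LocFin (hTerm N q τ lam hlam i j m n)) ∧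
  (∀ i m n, LocFin (eTerm N q τ lam hlam i m n)) ∧
  (∀ i m n, LocFin (esTerm N q τ lam hlam i m n)) ∧
  (∀ m n, LocFin (e0Term N q τ lam hlam m n))

end

/-- A linear map `π` makes `V` a module for the Lie superalgebra `L` (a graded subspace of the
central extension of `gl(1, 2N)(ℂ_q)` that is closed under the bracket): `V` has a
`ℤ/2`-grading for which `π` is even, and
`π [x, y] = π x π y - (-1)^(deg x deg y) π y π x` for homogeneous `x` and `y`. -/
def IsSuperModule {N : ℕ} {q : ℂˣ} {V : Type*} [AddCommGroup V] [Module ℂ V]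
    (L : Submodule ℂ (Hat N q)) (hL : ∀ x ∈ L, ∀ y ∈ L, hatBracket x y ∈ L)
    (π : L →ₗ[ℂ] Module.End ℂ V) : Prop :=
  (∃ 𝒱 : ZMod 2 → Submodule ℂ V, DirectSum.IsInternal 𝒱 ∧
    ∀ (α β : ZMod 2) (x : L), HatHomog α (x : Hat N q) → ∀ v ∈ 𝒱 β, π x v ∈ 𝒱 (α + β)) ∧
  ∀ (α β : ZMod 2) (x y : L), HatHomog α (x : Hat N q) → HatHomog β (y : Hat N q) →
    π ⟨hatBracket x y, hL x x.2 y y.2⟩ = π x * π y - sgn α β • (π y * π x)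

end QT

end

/-! The generators are treated uniformly as one family of fields `ψ r`, indexed by the rows `0`,
`i`, `N + i` (for `e`, `a_i`, `a_i^*`). Any two modes commute up to a colour factor `η r s` and a
scalar `B r s δ_{a+b,0}`, and every vector is killed by all sufficiently positive modes
(`IsFieldSystem`). All operators of the theorem are normally ordered quadratic fields in `ψ`,
corrected by a scalar (`quadShift`).

The core is the colour commutator of two such fields (`quadShift_comm`). Commuting a quadratic field
past a single mode gives two modes (`quad_mul_field`), so commuting it past a normally ordered
product gives four products of two modes. Restoring their normal order produces scalars, and since
`B` is colour antisymmetric these combine to differences of step functions. Such differences have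
finite support, so everything may be summed term by term. The resulting sum is a geometric
progression with halved end terms, with ratio `q^d`. It equals `m` if `q^d = 1`, which is the
cocycle of the `c(n)`. Otherwise it equals `(1/2)(q^d + 1)/(q^d - 1)(q^(dm) - 1)`, which is exactly
what the shift `σ` absorbs. Extended bilinearly to coefficients `u, v` in the quantum torus, the
four quadratic terms carry `uv`, `ū v`, `v ū`, `vu` (`quadLin_comm`).

A matrix unit `u e_{rs}` is sent to a signed quadratic field in `ψ r` and `ψ (dual s)`, where `dual`
exchanges `i` and `N + i`. The signs are chosen so that contracting two fields is matrix
multiplication (`form_dual_left`) and the double contraction is the supertrace (`form_dual_right`).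
Of the four terms, two then form the superbracket of `u e_{rs}` with `v e_{tw}`. The other two form
its superbracket with the image of `v e_{tw}` under the anti-involution attached to `S`
(`unitOp_comm`). Matrices in `S` are symmetric under that involution (`apply_dual_of_mem_SS`), so
both halves have the same total and the commutator of the matrix operators is twice the desired one
(`matOp_comm`). Halving the operators repairs this and forces `c(n) ↦ 1/2` (`hatOp_hatBracket`).

The grading is by the number of bosons modulo 2: bosonic modes are odd, `e(m)` is even, as are the
indices that label them. -/

noncomputable section

namespace QT

/-! ### Locally finite sums -/

section LocSum
variable {V : Type*} [AddCommGroup V] [Module ℂ V]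

/-- The family `t` of operators is locally finite with sum `T`. -/
def HasLocSum (t : ℤ → Module.End ℂ V) (T : Module.End ℂ V) : Prop :=
  ∀ v, (Function.support fun s => t s v).Finite ∧ ∑ᶠ s, t s v = T v

lemma LocFin.hasLocSum {t : ℤ → Module.End ℂ V} (h : LocFin t) : HasLocSum t (locSum t) := by
  intro v
  refine ⟨h v, ?_⟩
  rw [locSum, dif_pos h]
  rfl

namespace HasLocSum
variable {t t' : ℤ → Module.End ℂ V} {T T' : Module.End ℂ V}

/-- Operator identities below are proved by exhibiting both sides as sums of the same locally finite
family. -/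
lemma unique (h : HasLocSum t T) (h' : HasLocSum t T') : T = T' :=
  LinearMap.ext fun v => (h v).2.symm.trans (h' v).2

lemma add (h : HasLocSum t T) (h' : HasLocSum t' T') :
    HasLocSum (fun k => t k + t' k) (T + T') := fun v => by
  refine ⟨((h v).1.union (h' v).1).subset (Function.support_add _ _), ?_⟩
  simp only [LinearMap.add_apply]
  rw [finsum_add_distrib (h v).1 (h' v).1, (h v).2, (h' v).2]

lemma mul_left (A : Module.End ℂ V) (h : HasLocSum t T) :
    HasLocSum (fun k => A * t k) (A * T) := fun v => by
  refine ⟨(h v).1.subset fun k hk hk' => hk ?_, ?_⟩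
  · simp only at hk'
    simp [hk']
  · simp only [Module.End.mul_apply]
    rw [← (h v).2]
    exact (A.toAddMonoidHom.map_finsum (h v).1).symm

lemma mul_right (h : HasLocSum t T) (A : Module.End ℂ V) :
    HasLocSum (fun k => t k * A) (T * A) := fun v => h (A v)

lemma smul (c : ℂ) (h : HasLocSum t T) : HasLocSum (fun k => c • t k) (c • T) := by
  have := h.mul_left (c • 1)
  simpa using this

lemma sub (h : HasLocSum t T) (h' : HasLocSum t' T') :
    HasLocSum (fun k => t k - t' k) (T - T') := by
  have := h.add (h'.smul (-1))
  simpa [sub_eq_add_neg] using this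

lemma congr (h : HasLocSum t T) (ht : ∀ k, t' k = t k) (hT : T' = T) : HasLocSum t' T' := by
  obtain rfl : t' = t := funext ht
  exact hT ▸ h

lemma reindex (h : HasLocSum t T) (e : ℤ ≃ ℤ) : HasLocSum (fun k => t (e k)) T := fun v => by
  refine ⟨(h v).1.preimage (f := e) e.injective.injOn, ?_⟩
  rw [← (h v).2]
  exact finsum_comp_equiv e (f := fun k => t k v)

lemma single (k₀ : ℤ) (A : Module.End ℂ V) :
    HasLocSum (fun k => if k = k₀ then A else 0) A := fun v => by
  refine ⟨(Set.finite_singleton k₀).subset fun k hk => ?_, ?_⟩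
  · by_contra h
    exact hk (by simp [show k ≠ k₀ from h])
  · rw [finsum_eq_single _ k₀ fun k hk => by simp [hk]]
    simp

lemma zero : HasLocSum (fun _ => (0 : Module.End ℂ V)) 0 := fun v => by simp

end HasLocSum
end LocSum

/-! ### The step function and the central geometric sum -/

/-- The step function with value `1 / 2` at `0`. -/
def hstep (a : ℤ) : ℂ := if 0 < a then 1 else if a = 0 then 1 / 2 else 0

lemma hstep_add_hstep_neg (a : ℤ) : hstep a + hstep (-a) = 1 := by
  rcases lt_trichotomy a 0 with h | h | h
  · simp [hstep, h, h.not_gt, h.ne]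
  · subst h; norm_num [hstep]
  · simp [hstep, h, h.not_gt, h.ne']

/-- With the value `1/2` at `0`, a unit translation of the step function changes it by half a delta
at each of the two neighbouring jumps. -/
lemma hstep_neg_sub (k m : ℤ) : hstep (-(k + m)) - hstep (-(k + (m + 1))) =
    (if k = -m then 1 / 2 else 0) + (if k = -m - 1 then 1 / 2 else 0) := by
  unfold hstep
  by_cases h1 : k = -m
  · subst h1; norm_num; omega
  by_cases h2 : k = -m - 1
  · subst h2; norm_num
  rw [if_neg h1, if_neg h2]
  rcases lt_or_ge k (-m) with h | h
  · rw [if_pos (by omega), if_pos (by omega)]; norm_num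
  · rw [if_neg (by omega), if_neg (by omega), if_neg (by omega), if_neg (by omega)]; norm_num

lemma qpow_mul (q : ℂˣ) (d m : ℤ) : qpow q (d * m) = ((q ^ d) ^ m : ℂˣ) := by
  rw [qpow, zpow_mul]

lemma mem_Lam_iff {q : ℂˣ} {d : ℤ} : d ∈ Lam q ↔ qpow q d = 1 := by
  simp [Lam, qpow, Units.ext_iff]

open Classical in
/-- The value of the sum over `k` of `q ^ (-d k) (θ(-k) - θ(-(k + m)))`, `θ` the step function. -/
def stepSum (q : ℂˣ) (d m : ℤ) : ℂ :=
  (if d ∈ Lam q then (m : ℂ) else 0) + shift q 0 d * (qpow q (d * m) - 1)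

/-- Increasing `m` adds half of each of the two end terms of the geometric progression (trapezoidal
rule). The factor `(q^d + 1)/(q^d - 1)` in `shift` is what makes the closed form satisfy this
recursion when `q^d ≠ 1`. -/
lemma stepSum_succ (q : ℂˣ) (d m : ℤ) :
    stepSum q d (m + 1) = stepSum q d m + 1 / 2 * (qpow q (d * m) + qpow q (d * (m + 1))) := by
  unfold stepSum shift
  by_cases h : d ∈ Lam q
  · have h' : q ^ d = 1 := h
    simp [h, qpow_mul, h']
    norm_num
  · have h' : qpow q d - 1 ≠ 0 := fun h' => h (mem_Lam_iff.2 (sub_eq_zero.1 h'))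
    simp only [if_neg h, if_true, mul_add, mul_one, qpow_add]
    field_simp
    ring

/-- The scalar family telescopes in `m`: each unit step contributes two deltas, and both directions
of the induction start from the zero family at `m = 0`. -/
lemma hasLocSum_step {V : Type*} [AddCommGroup V] [Module ℂ V] (q : ℂˣ) (d m : ℤ) :
    HasLocSum (fun k => (qpow q (-(d * k)) * (hstep (-k) - hstep (-(k + m)))) •
      (1 : Module.End ℂ V)) (stepSum q d m • 1) := by
  have key (m : ℤ) : HasLocSum (fun k => (qpow q (-(d * k)) *
      (hstep (-(k + m)) - hstep (-(k + (m + 1))))) • (1 : Module.End ℂ V))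
      ((stepSum q d (m + 1) - stepSum q d m) • 1) := by
    refine ((HasLocSum.single (-m) ((1 / 2 * qpow q (d * m)) • 1)).add
      (HasLocSum.single (-m - 1) ((1 / 2 * qpow q (d * (m + 1))) • 1))).congr (fun k => ?_) ?_
    · rw [hstep_neg_sub]
      by_cases h1 : k = -m
      · subst h1
        have h2 : ¬ (-m = -m - 1) := by omega
        simp only [if_true, if_neg h2, add_zero]
        congr 1
        rw [mul_comm]; congr 2; ring
      · by_cases h2 : k = -m - 1
        · subst h2
          simp only [if_true, if_neg h1, zero_add]
          congr 1
          rw [mul_comm]; congr 2; ring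
        · simp [h1, h2]
    · rw [stepSum_succ, ← add_smul]
      congr 1
      ring
  induction m using Int.induction_on with
  | zero => simpa [stepSum] using HasLocSum.zero
  | succ m ih =>
    refine (ih.add (key m)).congr (fun k => ?_) ?_
    · rw [← add_smul]; congr 1; ring
    · rw [← add_smul]; congr 1; ring
  | pred m ih =>
    have hk := key (-(m : ℤ) - 1)
    rw [sub_add_cancel] at hk
    refine (ih.sub hk).congr (fun k => ?_) ?_
    · rw [← sub_smul]; congr 1; ring
    · rw [← sub_smul]; congr 1; ring

/-- Oddness of the shift is what lets the corrected quadratic fields keep the exchange symmetry of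
the uncorrected ones, see `quadShift_swap`. -/
lemma shift_neg (q : ℂˣ) (n : ℤ) : shift q 0 (-n) = - shift q 0 n := by
  have e : -n ∈ Lam q ↔ n ∈ Lam q := by simp [Lam]
  unfold shift
  by_cases hn : n ∈ Lam q
  · simp [e, hn]
  · have h1 : qpow q n - 1 ≠ 0 := fun h' => hn (mem_Lam_iff.2 (sub_eq_zero.1 h'))
    have h2 : qpow q (-n) * qpow q n = 1 := by rw [← qpow_add]; simp
    have h3 : qpow q (-n) - 1 ≠ 0 := fun h' => hn (e.1 (mem_Lam_iff.2 (sub_eq_zero.1 h')))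
    simp only [e, hn, if_true, if_false]
    field_simp
    linear_combination 2 * h2

/-! ### Systems of fields and their normally ordered quadratic expressions -/

section Fields
variable {V : Type*} [AddCommGroup V] [Module ℂ V] {I : Type*}

/-- Fields `ψ r` whose modes commute up to the colour factors `η r s` and the central terms
`B r s δ_{a+b,0}`, and whose positive modes are eventually zero on every vector. -/
structure IsFieldSystem (ψ : I → ℤ → Module.End ℂ V) (η B : I → I → ℂ) : Prop where
  comm (r s : I) (a b : ℤ) :
    ψ r a * ψ s b = η r s • (ψ s b * ψ r a) + (if a + b = 0 then B r s else 0) • 1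
  eta_mul_self (r s : I) : η r s * η r s = 1
  eta_symm (r s : I) : η r s = η s r
  -- Consistency of `comm` with itself after exchanging the two modes.
  form_symm (r s : I) : B s r = -(η r s * B r s)
  -- Fields with a nonzero contraction have the same colour, so contractions are colour neutral:
  -- moving a third field past both produces no sign.
  eta_eq (r s t : I) : B r s ≠ 0 → η r t = η s t
  eventually_zero (r : I) (v : V) : ∃ K : ℤ, ∀ a, K < a → ψ r a v = 0

/-- The normally ordered product of two modes. -/
def normalProd (ψ : I → ℤ → Module.End ℂ V) (B : I → I → ℂ) (r s : I) (a b : ℤ) :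
    Module.End ℂ V :=
  ψ r a * ψ s b - (if a + b = 0 then B r s * hstep a else 0) • 1

/-- The `k`-th term of the quadratic field. -/
def quadTerm (ψ : I → ℤ → Module.End ℂ V) (B : I → I → ℂ) (q : ℂˣ) (r s : I) (m n k : ℤ) :
    Module.End ℂ V :=
  qpow q (-(n * k)) • normalProd ψ B r s (m - k) k

/-- The quadratic field `∑ k, q ^ (-n k) :ψ r (m - k) ψ s k:`. -/
def quad (ψ : I → ℤ → Module.End ℂ V) (B : I → I → ℂ) (q : ℂˣ) (r s : I) (m n : ℤ) :
    Module.End ℂ V :=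
  locSum (quadTerm ψ B q r s m n)

/-- The quadratic field with its central shift. -/
def quadShift (ψ : I → ℤ → Module.End ℂ V) (B : I → I → ℂ) (q : ℂˣ) (r s : I) (m n : ℤ) :
    Module.End ℂ V :=
  quad ψ B q r s m n - (if m = 0 then B r s * shift q 0 n else 0) • 1

/-- The quadratic field as a linear function of the coefficient `u = x ^ m * y ^ n`. -/
def quadLin (ψ : I → ℤ → Module.End ℂ V) (B : I → I → ℂ) (q : ℂˣ) (r s : I) :
    QTorus q →ₗ[ℂ] Module.End ℂ V :=
  lin q (quadShift ψ B q r s)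

open Classical in
/-- The scalar that the central extension contributes: `m q ^ (n p)` if `m + p = 0` and
`n + l ∈ Λ(q)`, else `0`. -/
def kapSum (q : ℂˣ) (m n p l : ℤ) : ℂ :=
  if m + p = 0 ∧ n + l ∈ Lam q then (m : ℂ) * qpow q (n * p) else 0

/-- The bilinear form with the values `kapSum`. -/
def kapLin (q : ℂˣ) : QTorus q →ₗ[ℂ] QTorus q →ₗ[ℂ] ℂ :=
  lin q fun m n => lin q fun p l => kapSum q m n p l

lemma QTorus.induction {q : ℂˣ} {P : QTorus q → Prop} (u : QTorus q) (zero : P 0)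
    (add : ∀ u v, P u → P v → P (u + v)) (smul : ∀ (c : ℂ) u, P u → P (c • u))
    (mono : ∀ m n, P (mono q m n)) : P u := by
  refine Finsupp.induction_linear (motive := P) u zero add fun a c => ?_
  have : (Finsupp.single a c : ℤ × ℤ →₀ ℂ) = c • (QT.mono q a.1 a.2 : QTorus q) := by
    change _ = c • (Finsupp.single a 1 : ℤ × ℤ →₀ ℂ)
    simp
  exact this ▸ smul c _ (mono _ _)

/-- The form is supported on `m + p = 0` and `q^n = q^l`; there the powers of `q` cancel and both
sides are equal to `m`. -/
lemma kapLin_bar (q : ℂˣ) (u v : QTorus q) : kapLin q (bar q u) v = kapLin q u (bar q v) := by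
  have : (kapLin q).comp (bar q) = (kapLin q).compl₂ (bar q) := by
    refine lin_ext fun m n => lin_ext fun p l => ?_
    simp only [LinearMap.comp_apply, LinearMap.compl₂_apply, kapLin, bar, lin_mono, map_smul,
      LinearMap.smul_apply, smul_eq_mul, kapSum]
    have e : n + -l ∈ Lam q ↔ -n + l ∈ Lam q := by
      rw [Lam, Set.mem_ofPred_eq, Set.mem_ofPred_eq, ← inv_eq_one, ← zpow_neg]
      simp [add_comm]
    rw [e]
    split_ifs with hc
    · obtain ⟨h1, h2⟩ := hc
      obtain rfl : p = -m := by omega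
      have h2 : q ^ (-n + l) = 1 := h2
      have c1 : qpow q (-(n * m)) * qpow q (-n * -m) = 1 := by
        rw [← qpow_add, ← qpow_zero q]; congr 1; ring
      have c2 : qpow q (-(l * -m)) * qpow q (n * -m) = 1 := by
        rw [← qpow_add, show -(l * -m) + n * -m = (-n + l) * m by ring, qpow_mul, h2]; simp
      linear_combination (m : ℂ) * c1 - m * c2
    · simp
  exact congrArg (fun L => L u v) this

/-! ### Commutation relations of the quadratic fields -/

namespace IsFieldSystem
variable {ψ : I → ℤ → Module.End ℂ V} {η B : I → I → ℂ} (h : IsFieldSystem ψ η B)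
include h

lemma eta_mul_form (r s t : I) : η r t * B r s = η s t * B r s := by
  by_cases hB : B r s = 0
  · simp [hB]
  · rw [h.eta_eq r s t hB]

lemma eta_eta_form (r s t : I) : η r t * η s t * B r s = B r s := by
  rw [mul_right_comm, h.eta_mul_form, mul_right_comm, h.eta_mul_self, one_mul]

lemma locFin_quadTerm (q : ℂˣ) (r s : I) (m n : ℤ) : LocFin (quadTerm ψ B q r s m n) := by
  intro v
  obtain ⟨K, hK⟩ := h.eventually_zero s v
  obtain ⟨L, hL⟩ := h.eventually_zero r v
  refine (Set.finite_Icc (min (m - L) (min 0 m)) (max K (max 0 m))).subset fun k hk => ?_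
  by_contra hk'
  rw [Set.mem_Icc, not_and_or, not_le, not_le] at hk'
  refine hk ?_
  have hc := h.comm r s (m - k) k
  -- For very negative `k` the modes are exchanged so that `ψ r (m - k)` acts first; the step
  -- function is `1` there and its contraction cancels the commutator scalar. For large `k` the mode
  -- `ψ s k` already acts first and the step function is `0`.
  rcases hk' with hk' | hk'
  · have h1 : L < m - k := by omega
    have h2 : k < m := by omega
    simp [quadTerm, normalProd, hc, hL _ h1, hstep, h2]
  · have h1 : K < k := by omega
    have h2 : ¬ (k < m) := by omega
    have h3 : ¬ (m - k = 0) := by omega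
    simp [quadTerm, normalProd, hK _ h1, hstep, h2, h3]

lemma hasLocSum_quad (q : ℂˣ) (r s : I) (m n : ℤ) :
    HasLocSum (quadTerm ψ B q r s m n) (quad ψ B q r s m n) :=
  (h.locFin_quadTerm q r s m n).hasLocSum

/-- The contractions for the two orders add up to the full commutator scalar because the step
function satisfies `θ(a) + θ(-a) = 1`. -/
lemma normalProd_swap (r s : I) (a b : ℤ) :
    normalProd ψ B r s a b = η r s • normalProd ψ B s r b a := by
  unfold normalProd
  rw [h.comm r s a b, add_comm b a]
  by_cases hab : a + b = 0
  · obtain rfl : b = -a := by omega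
    have e1 := h.form_symm r s
    have e2 := h.eta_mul_self r s
    have e3 := hstep_add_hstep_neg a
    simp only [hab, if_true]
    rw [smul_sub, smul_smul, e1, add_sub_assoc, ← sub_smul, sub_eq_add_neg (_ • (_ * _)), ← neg_smul]
    congr 2
    linear_combination -B r s * e3 - B r s * hstep (-a) * e2
  · simp [hab]

/-- The mode `ψ t c` is moved past `ψ s b` and then past `ψ r a`. The contraction of `r` with `s`
passes through unchanged, being colour neutral. -/
lemma normalProd_mul_field (r s t : I) (a b c : ℤ) :
    normalProd ψ B r s a b * ψ t c = (η r t * η s t) • (ψ t c * normalProd ψ B r s a b)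
      + (if b + c = 0 then B s t else 0) • ψ r a
      + (if a + c = 0 then η s t * B r t else 0) • ψ s b := by
  have e : η r t * η s t * (if a + b = 0 then B r s * hstep a else 0)
      = if a + b = 0 then B r s * hstep a else 0 := by
    split_ifs
    · rw [← mul_assoc, h.eta_eta_form]
    · simp
  unfold normalProd
  rw [sub_mul, mul_assoc, h.comm s t b c, mul_add, mul_smul_comm, ← mul_assoc, h.comm r t a c]
  simp only [add_mul, mul_sub, smul_mul_assoc, mul_smul_comm, one_mul, mul_one, smul_add, smul_sub,
    smul_smul, mul_assoc, e, mul_ite, mul_zero]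
  module

/-- Each of the two contractions with `ψ t a` meets exactly one term of the sum: `k = -a` for the
second factor and `k = m + a` for the first. -/
lemma quad_mul_field (q : ℂˣ) (r s t : I) (m n a : ℤ) :
    quad ψ B q r s m n * ψ t a = (η r t * η s t) • (ψ t a * quad ψ B q r s m n)
      + (B s t * qpow q (n * a)) • ψ r (m + a)
      + (η s t * B r t * qpow q (-(n * (m + a)))) • ψ s (m + a) := by
  have hq := h.hasLocSum_quad q r s m n
  have h1 := (hq.mul_right (ψ t a)).sub ((hq.mul_left (ψ t a)).smul (η r t * η s t))
  have h2 := (HasLocSum.single (-a) ((B s t * qpow q (n * a)) • ψ r (m + a))).add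
    (HasLocSum.single (m + a) ((η s t * B r t * qpow q (-(n * (m + a)))) • ψ s (m + a)))
  rw [add_assoc, ← sub_eq_iff_eq_add']
  refine h1.unique (h2.congr (fun k => ?_) rfl)
  unfold quadTerm
  rw [smul_mul_assoc, mul_smul_comm, h.normalProd_mul_field]
  have e1 : k + a = 0 ↔ k = -a := by omega
  have e2 : m - k + a = 0 ↔ k = m + a := by omega
  simp only [e1, e2]
  have s1 : qpow q (-(n * k)) • (if k = -a then B s t else 0) • ψ r (m - k)
      = if k = -a then (B s t * qpow q (n * a)) • ψ r (m + a) else 0 := by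
    split_ifs with hk
    · subst hk; rw [smul_smul, mul_comm]; congr 2
      · congr 1; ring
      · ring
    · simp
  have s2 : qpow q (-(n * k)) • (if k = m + a then η s t * B r t else 0) • ψ s k
      = if k = m + a then (η s t * B r t * qpow q (-(n * (m + a)))) • ψ s (m + a) else 0 := by
    split_ifs with hk
    · subst hk; rw [smul_smul, mul_comm]
    · simp
  rw [← s1, ← s2]
  module

/-- Exchange the two factors and substitute `k ↦ m - k`. -/
lemma quad_swap (q : ℂˣ) (r s : I) (m n : ℤ) :
    quad ψ B q r s m n = (η r s * qpow q (-(n * m))) • quad ψ B q s r m (-n) := by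
  refine (h.hasLocSum_quad q r s m n).unique ((((h.hasLocSum_quad q s r m (-n)).smul
    (η r s * qpow q (-(n * m)))).reindex (Equiv.subLeft m)).congr (fun k => ?_) rfl)
  simp only [quadTerm, Equiv.subLeft_apply, sub_sub_cancel]
  rw [h.normalProd_swap, smul_smul, smul_smul, mul_assoc, ← qpow_add, mul_comm]
  congr 3
  ring

lemma quadShift_swap (q : ℂˣ) (r s : I) (m n : ℤ) :
    quadShift ψ B q r s m n = (η r s * qpow q (-(n * m))) • quadShift ψ B q s r m (-n) := by
  unfold quadShift
  rw [h.quad_swap, smul_sub, h.form_symm r s, shift_neg, smul_smul]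
  congr 2
  split_ifs with hm
  · subst hm
    simp only [mul_zero, neg_zero, qpow_zero, mul_one]
    linear_combination -(B r s * shift q 0 n) * h.eta_mul_self r s
  · simp

/-- This and `form_form_inner` say that the four contractions arising in the commutator come in two
pairs of opposite sign. That is why only differences of step functions survive. -/
lemma form_form_outer (r s t w : I) :
    η r t * η s t * (η s w * B r w) * B t s = - (B s t * B r w) := by
  rw [h.form_symm s t]
  linear_combination - η r t * η s w * B r w * B s t * h.eta_mul_self s t
    - η r t * B r w * h.eta_mul_form s t w
    - η t w * B s t * h.eta_mul_form r w t
    - η t w * B s t * B r w * h.eta_symm w t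
    - B s t * B r w * h.eta_mul_self t w

lemma form_form_inner (r s t w : I) :
    η r t * η s t * B s w * B t r = - (η s t * B r t * B s w) := by
  rw [h.form_symm r t]
  linear_combination - η s t * B s w * B r t * h.eta_mul_self r t

/-- The commutator is taken with a single term of the second field, so that no divergent scalar sum
ever appears: at fixed `k` the contractions already combine to a difference of step functions.
Replacing `ψ t` or `ψ w` by a field of the first operator shifts the mode by `m`, whence the index
`k + m` in two of the four terms. -/
lemma quadTerm_comm (q : ℂˣ) (r s t w : I) (m n p l k : ℤ) :
    quad ψ B q r s m n * quadTerm ψ B q t w p l k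
        - (η r t * η s t * (η r w * η s w)) • (quadTerm ψ B q t w p l k * quad ψ B q r s m n)
      = (B s t * qpow q (n * p)) • quadTerm ψ B q r w (m + p) (n + l) k
      + (η s t * B r t * qpow q (-(n * (m + p)))) • quadTerm ψ B q s w (m + p) (l - n) k
      + (η r t * η s t * B s w * qpow q (-((n - l) * m))) •
          quadTerm ψ B q t r (m + p) (l - n) (k + m)
      + (η r t * η s t * (η s w * B r w) * qpow q (l * m)) •
          quadTerm ψ B q t s (m + p) (n + l) (k + m)
      + (if m + p = 0 then B s t * B r w * qpow q (n * p) else 0) •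
          (qpow q (-((n + l) * k)) * (hstep (-k) - hstep (-(k + m)))) • (1 : Module.End ℂ V)
      + (if m + p = 0 then η s t * B r t * B s w else 0) •
          (qpow q (-((l - n) * k)) * (hstep (-k) - hstep (-(k + m)))) • (1 : Module.End ℂ V) := by
  -- Derivation property: `quad` is moved past `ψ t a` and then past `ψ w b`, and the contraction of
  -- `t` with `w` drops out.
  have comm2 (a b : ℤ) : quad ψ B q r s m n * normalProd ψ B t w a b
      - (η r t * η s t * (η r w * η s w)) • (normalProd ψ B t w a b * quad ψ B q r s m n)
      = (B s t * qpow q (n * a)) • (ψ r (m + a) * ψ w b)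
      + (η s t * B r t * qpow q (-(n * (m + a)))) • (ψ s (m + a) * ψ w b)
      + (η r t * η s t * (B s w * qpow q (n * b))) • (ψ t a * ψ r (m + b))
      + (η r t * η s t * (η s w * B r w * qpow q (-(n * (m + b))))) • (ψ t a * ψ s (m + b)) := by
    have e : η r t * η s t * (η r w * η s w) * (if a + b = 0 then B t w * hstep a else 0)
        = if a + b = 0 then B t w * hstep a else 0 := by
      split_ifs
      · have e1 := h.eta_eta_form t w r
        have e2 := h.eta_eta_form t w s
        rw [h.eta_symm t r, h.eta_symm w r] at e1
        rw [h.eta_symm t s, h.eta_symm w s] at e2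
        linear_combination hstep a * η r t * η r w * e2 + hstep a * e1
      · simp
    unfold normalProd
    rw [mul_sub, ← mul_assoc, h.quad_mul_field]
    simp only [add_mul, sub_mul, smul_mul_assoc, mul_smul_comm, mul_one, one_mul, mul_assoc (ψ t a),
      h.quad_mul_field q r s w, mul_add, smul_add, smul_sub, smul_smul, e]
    module
  have prod (r s : I) (a b : ℤ) : ψ r a * ψ s b
      = normalProd ψ B r s a b + (if a + b = 0 then B r s * hstep a else 0) • 1 := by
    rw [normalProd, sub_add_cancel]
  unfold quadTerm
  rw [mul_smul_comm, smul_mul_assoc, smul_comm _ (qpow q (-(l * k))), ← smul_sub, comm2,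
    prod r w, prod s w, prod t r, prod t s]
  have a1 : m + (p - k) = m + p - k := by ring
  have a2 : m + p - (k + m) = p - k := by ring
  have a3 : p - k + (k + m) = m + p := by ring
  have a4 : m + p - k + k = m + p := by ring
  have E1 : qpow q (-(l * k)) * qpow q (n * (p - k))
      = qpow q (n * p) * qpow q (-((n + l) * k)) := by
    rw [← qpow_add, ← qpow_add]; congr 1; ring
  have E2 : qpow q (-(l * k)) * qpow q (-(n * (m + (p - k))))
      = qpow q (-(n * (m + p))) * qpow q (-((l - n) * k)) := by
    rw [← qpow_add, ← qpow_add]; congr 1; ring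
  have E3 : qpow q (-(l * k)) * qpow q (n * k)
      = qpow q (-((n - l) * m)) * qpow q (-((l - n) * (k + m))) := by
    rw [← qpow_add, ← qpow_add]; congr 1; ring
  have E4 : qpow q (-(l * k)) * qpow q (-(n * (m + k)))
      = qpow q (l * m) * qpow q (-((n + l) * (k + m))) := by
    rw [← qpow_add, ← qpow_add]; congr 1; ring
  have S1 := h.form_form_outer r s t w
  have S2 := h.form_form_inner r s t w
  simp only [smul_add, smul_smul, add_comm m k, a1, a2, a3, a4] at E1 E2 E3 E4 ⊢
  -- The identities between powers of `q`, each multiplied by the normally ordered product that it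
  -- accompanies.
  have main := congrArg₂ (· + ·)
    (congrArg₂ (· + ·) (congrArg (· • B s t • normalProd ψ B r w (m + p - k) k) E1)
      (congrArg (· • (η s t * B r t) • normalProd ψ B s w (m + p - k) k) E2))
    (congrArg₂ (· + ·)
      (congrArg (· • (η r t * η s t * B s w) • normalProd ψ B t r (p - k) (k + m)) E3)
      (congrArg (· • (η r t * η s t * (η s w * B r w)) • normalProd ψ B t s (p - k) (k + m)) E4))
  by_cases hmp : m + p = 0
  · obtain rfl : p = -m := by omega
    simp only [hmp, if_true]
    have G1 : -m - k = -(k + m) := by ring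
    simp only [G1, add_neg_cancel, zero_sub, mul_zero, neg_zero, qpow_zero, one_mul]
      at E1 E2 E3 E4 main ⊢
    have E5 : qpow q (l * m) * qpow q (-((n + l) * (k + m)))
      = qpow q (n * -m) * qpow q (-((n + l) * k)) := by
      rw [← qpow_add, ← qpow_add]; congr 1; ring
    have E6 : qpow q (-((n - l) * m)) * qpow q (-((l - n) * (k + m)))
      = qpow q (-((l - n) * k)) := by
      rw [← qpow_add]; congr 1; ring
    -- The same identities multiplied by the contractions. `S1`, `E5` and `S2`, `E6` give the terms
    -- at `k + m` the same powers as those at `k`, with opposite sign.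
    have scal := congrArg₂ (· + ·)
      (congrArg₂ (· + ·) (congrArg (· * (B s t * B r w * hstep (-k))) E1)
        (congrArg (· * (η s t * B r t * B s w * hstep (-k))) E2))
      (congrArg₂ (· + ·)
        (congrArg (· * (η r t * η s t * B s w * B t r * hstep (-(k + m)))) E3)
        (congrArg (· * (η r t * η s t * (η s w * B r w) * B t s * hstep (-(k + m)))) E4))
    conv_rhs at scal => simp only [S1, S2, E5, E6]
    linear_combination (norm := module) main + scal • (1 : Module.End ℂ V)
  · simp only [hmp, if_false, mul_zero, zero_smul, add_zero]
    linear_combination (norm := module) main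

/-- Summation of `quadTerm_comm` over `k`; the two families indexed by `k + m` are translated back.
-/
lemma quad_comm (q : ℂˣ) (r s t w : I) (m n p l : ℤ) :
    quad ψ B q r s m n * quad ψ B q t w p l
        - (η r t * η s t * (η r w * η s w)) • (quad ψ B q t w p l * quad ψ B q r s m n)
      = (B s t * qpow q (n * p)) • quad ψ B q r w (m + p) (n + l)
      + (η s t * B r t * qpow q (-(n * (m + p)))) • quad ψ B q s w (m + p) (l - n)
      + (η r t * η s t * B s w * qpow q (-((n - l) * m))) • quad ψ B q t r (m + p) (l - n)
      + (η r t * η s t * (η s w * B r w) * qpow q (l * m)) • quad ψ B q t s (m + p) (n + l)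
      + (if m + p = 0 then B s t * B r w * qpow q (n * p) else 0) •
          stepSum q (n + l) m • (1 : Module.End ℂ V)
      + (if m + p = 0 then η s t * B r t * B s w else 0) •
          stepSum q (l - n) m • (1 : Module.End ℂ V) := by
  have hY := h.hasLocSum_quad q t w p l
  refine ((hY.mul_left _).sub ((hY.mul_right _).smul _)).unique
    ((((((h.hasLocSum_quad q r w _ _).smul _).add ((h.hasLocSum_quad q s w _ _).smul _)).add
      (((h.hasLocSum_quad q t r _ _).reindex (Equiv.addRight m)).smul _)).add
      (((h.hasLocSum_quad q t s _ _).reindex (Equiv.addRight m)).smul _)).add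
      ((hasLocSum_step q (n + l) m).smul _) |>.add
      ((hasLocSum_step q (l - n) m).smul _) |>.congr (fun k => ?_) rfl)
  exact h.quadTerm_comm q r s t w m n p l k

/-- Scalar shifts do not affect the left side, since the total colour factor is `1` wherever a shift
is nonzero. On the right side the shifts of the four fields cancel the part of `stepSum`
proportional to `q^(dm) - 1`, leaving only the part with `d ∈ Λ(q)`. -/
lemma quadShift_comm (q : ℂˣ) (r s t w : I) (m n p l : ℤ) :
    quadShift ψ B q r s m n * quadShift ψ B q t w p l
        - (η r t * η s t * (η r w * η s w)) •
          (quadShift ψ B q t w p l * quadShift ψ B q r s m n)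
      = (B s t * qpow q (n * p)) • quadShift ψ B q r w (m + p) (n + l)
      + (η s t * B r t * qpow q (-(n * (m + p)))) • quadShift ψ B q s w (m + p) (l - n)
      + (η r t * η s t * B s w * qpow q (-((n - l) * m))) • quadShift ψ B q t r (m + p) (l - n)
      + (η r t * η s t * (η s w * B r w) * qpow q (l * m)) •
          quadShift ψ B q t s (m + p) (n + l)
      + (B s t * B r w * kapSum q m n p l) • (1 : Module.End ℂ V)
      + (η s t * B r t * B s w * (qpow q (-(n * m)) * kapSum q m (-n) p l)) •
          (1 : Module.End ℂ V) := by
  have e1 (c : ℂ) : η r t * η s t * (η r w * η s w) * (if m = 0 then B r s * c else 0)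
      = if m = 0 then B r s * c else 0 := by
    split_ifs
    · linear_combination c * η r w * η s w * h.eta_eta_form r s t + c * h.eta_eta_form r s w
    · simp
  have e2 (c : ℂ) : η r t * η s t * (η r w * η s w) * (if p = 0 then B t w * c else 0)
      = if p = 0 then B t w * c else 0 := by
    split_ifs
    · have e1 := h.eta_eta_form t w r
      have e2 := h.eta_eta_form t w s
      rw [h.eta_symm t r, h.eta_symm w r] at e1
      rw [h.eta_symm t s, h.eta_symm w s] at e2
      linear_combination c * η r t * η r w * e2 + c * e1
    · simp
  have hc : quadShift ψ B q r s m n * quadShift ψ B q t w p l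
        - (η r t * η s t * (η r w * η s w)) •
          (quadShift ψ B q t w p l * quadShift ψ B q r s m n) =
      quad ψ B q r s m n * quad ψ B q t w p l
        - (η r t * η s t * (η r w * η s w)) • (quad ψ B q t w p l * quad ψ B q r s m n) := by
    unfold quadShift
    simp only [sub_mul, mul_sub, smul_mul_assoc, mul_smul_comm, one_mul, mul_one, smul_sub,
      smul_smul, e1, e2]
    rw [← mul_assoc (_ * (_ * _)) (ite _ _ _), e1]
    module
  rw [hc, h.quad_comm]
  unfold quadShift
  by_cases hmp : m + p = 0
  · obtain rfl : p = -m := by omega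
    have S1 := h.form_form_outer r s t w
    have S2 := h.form_form_inner r s t w
    -- The surviving cocycle is `stepSum` minus its coboundary part.
    have K (n' : ℤ) : kapSum q m n' (-m) l
        = (stepSum q (n' + l) m - shift q 0 (n' + l) * (qpow q ((n' + l) * m) - 1))
          * qpow q (n' * -m) := by
      unfold kapSum stepSum
      by_cases hd : n' + l ∈ Lam q <;> simp [hd]
    have Q1 : qpow q (-(n * m)) * qpow q (-n * -m) = 1 := by
      rw [← qpow_add, ← qpow_zero q]; congr 1; ring
    have Q2 : qpow q ((n + l) * m) * qpow q (n * -m) = qpow q (l * m) := by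
      rw [← qpow_add]; congr 1; ring
    have Q3 : qpow q (-((n - l) * m)) = qpow q ((l - n) * m) := by congr 1; ring
    have d : -n + l = l - n := by ring
    simp only [hmp, if_true, K, d, Q3, mul_zero, neg_zero, qpow_zero, smul_sub, smul_smul]
    have scal : B s t * B r w * qpow q (n * -m) * stepSum q (n + l) m
        + η s t * B r t * B s w * stepSum q (l - n) m
      = - (B s t * qpow q (n * -m) * (B r w * shift q 0 (n + l)))
        - η s t * B r t * (B s w * shift q 0 (l - n))
        - η r t * η s t * B s w * qpow q ((l - n) * m) * (B t r * shift q 0 (l - n))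
        - η r t * η s t * (η s w * B r w) * qpow q (l * m) * (B t s * shift q 0 (n + l))
        + B s t * B r w * ((stepSum q (n + l) m - shift q 0 (n + l) *
          (qpow q ((n + l) * m) - 1)) * qpow q (n * -m))
        + η s t * B r t * B s w * (qpow q (-(n * m)) * ((stepSum q (l - n) m -
          shift q 0 (l - n) * (qpow q ((l - n) * m) - 1)) * qpow q (-n * -m))) := by
      linear_combination qpow q (l * m) * shift q 0 (n + l) * S1
        + qpow q ((l - n) * m) * shift q 0 (l - n) * S2
        + B s t * B r w * shift q 0 (n + l) * Q2
        - η s t * B r t * B s w * (stepSum q (l - n) m -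
          shift q 0 (l - n) * (qpow q ((l - n) * m) - 1)) * Q1
    linear_combination (norm := module) scal • (1 : Module.End ℂ V)
  · have hk (n : ℤ) : kapSum q m n p l = 0 := if_neg fun h' => hmp h'.1
    simp [hmp, hk]

lemma quadLin_swap (q : ℂˣ) (r s : I) (u : QTorus q) :
    quadLin ψ B q r s u = η r s • quadLin ψ B q s r (bar q u) := by
  induction u using QTorus.induction with
  | zero => simp
  | add u v hu hv => simp only [map_add, hu, hv, smul_add]
  | smul c u hu => simp only [map_smul, hu, smul_comm c]
  | mono m n =>
    simp only [quadLin, lin_mono, bar, map_smul, smul_smul]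
    exact h.quadShift_swap q r s m n

/-- On monomials the powers of `q` in `quadShift_comm` are precisely the structure constants of the
quantum torus and of `bar`. -/
lemma quadLin_comm (q : ℂˣ) (r s t w : I) (u v : QTorus q) :
    quadLin ψ B q r s u * quadLin ψ B q t w v
        - (η r t * η s t * (η r w * η s w)) • (quadLin ψ B q t w v * quadLin ψ B q r s u)
      = B s t • quadLin ψ B q r w (u * v)
      + (η s t * B r t) • quadLin ψ B q s w (bar q u * v)
      + (η r t * η s t * B s w) • quadLin ψ B q t r (v * bar q u)
      + (η r t * η s t * (η s w * B r w)) • quadLin ψ B q t s (v * u)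
      + (B s t * B r w * kapLin q u v) • (1 : Module.End ℂ V)
      + (η s t * B r t * B s w * kapLin q (bar q u) v) • (1 : Module.End ℂ V) := by
  induction u using QTorus.induction with
  | zero => simp
  | add u u' hu hu' =>
    simp only [map_add, add_mul, mul_add, LinearMap.add_apply]
    linear_combination (norm := module) hu + hu'
  | smul c u hu =>
    simp only [map_smul, smul_mul_assoc, mul_smul_comm, LinearMap.smul_apply, smul_eq_mul]
    linear_combination (norm := module) c • hu
  | mono m n =>
    induction v using QTorus.induction with
    | zero => simp
    | add u u' hu hu' =>
      simp only [map_add, add_mul, mul_add]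
      linear_combination (norm := module) hu + hu'
    | smul c u hu =>
      simp only [map_smul, smul_mul_assoc, mul_smul_comm, smul_eq_mul]
      linear_combination (norm := module) c • hu
    | mono p l =>
      have c1 : qpow q (-(n * m)) * qpow q (-n * p) = qpow q (-(n * (m + p))) := by
        rw [← qpow_add]; congr 1; ring
      have c2 : qpow q (-(n * m)) * qpow q (l * m) = qpow q (-((n - l) * m)) := by
        rw [← qpow_add]; congr 1; ring
      have c3 : -n + l = l - n := by ring
      have c4 : l + -n = l - n := by ring
      simp only [quadLin, kapLin, bar, lin_mono, mono_mul_mono, map_smul, smul_mul_assoc,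
        mul_smul_comm, LinearMap.smul_apply, smul_smul, smul_eq_mul, mul_assoc, c1, c2, c3, c4,
        add_comm p m, add_comm l n]
      simpa only [mul_assoc] using h.quadShift_comm q r s t w m n p l

end IsFieldSystem
end Fields

/-! ### The fields on the Fock space -/

/-- The colour factors: `-1` for two fermions, `1` for two bosons, `-τ` otherwise. -/
def eta {N : ℕ} (τ : ℤˣ) : Ix N → Ix N → ℂ
  | Sum.inl _, Sum.inl _ => -1
  | Sum.inl _, Sum.inr _ => -((τ : ℤ) : ℂ)
  | Sum.inr _, Sum.inl _ => -((τ : ℤ) : ℂ)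
  | Sum.inr _, Sum.inr _ => 1

/-- The commutation form of the fields. -/
def form {N : ℕ} : Ix N → Ix N → ℂ
  | Sum.inl _, Sum.inl _ => -1
  | Sum.inr (Sum.inl i), Sum.inr (Sum.inr j) => if i = j then -1 else 0
  | Sum.inr (Sum.inr i), Sum.inr (Sum.inl j) => if i = j then 1 else 0
  | _, _ => 0

/-- A polynomial involves finitely many variables, and for large index the mode is a derivative in
an absent variable. -/
lemma bosA_eventually_zero {N : ℕ} (i : Fin N) (p : Bos N) :
    ∃ K : ℤ, ∀ a, K < a → bosA i a p = 0 := by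
  classical
  obtain ⟨K, hK⟩ := (p.vars.image Prod.snd).exists_le
  refine ⟨max K 0, fun a ha => ?_⟩
  have h1 : ¬ (a ≤ 0) := by omega
  have h2 : (i, a) ∉ p.vars := fun hm => by
    have := hK a (Finset.mem_image_of_mem Prod.snd hm)
    omega
  simp [bosA, h1, MvPolynomial.pderiv_eq_zero_of_notMem_vars h2]

lemma bosAs_eventually_zero {N : ℕ} (i : Fin N) (p : Bos N) :
    ∃ K : ℤ, ∀ a, K < a → bosAs i a p = 0 := by
  classical
  obtain ⟨K, hK⟩ := (p.vars.image fun x => -x.2).exists_le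
  refine ⟨max K 0, fun a ha => ?_⟩
  have h1 : ¬ (a < 0) := by omega
  have h2 : (i, -a) ∉ p.vars := fun hm => by
    have := hK _ (Finset.mem_image_of_mem (fun x => -x.2) hm)
    simp only at this
    omega
  simp [bosAs, h1, MvPolynomial.pderiv_eq_zero_of_notMem_vars h2]

section
open CliffordAlgebra

/-- A vector of the exterior algebra involves finitely many basis vectors, and contraction with any
other coordinate kills it. -/
lemma ferE_eventually_zero (lam : ℂ) (x : Fer) : ∃ K : ℤ, ∀ a, K < a → ferE lam a x = 0 := by
  suffices h : ∃ K : ℕ, ∀ k, K ≤ k →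
      contractLeft (Q := (0 : QuadraticForm ℂ (ℕ →₀ ℂ))) (Finsupp.lapply k) x = 0 by
    obtain ⟨K, hK⟩ := h
    refine ⟨K, fun a ha => ?_⟩
    match a, ha with
    | Int.ofNat 0, ha => simp at ha; omega
    | Int.negSucc k, ha => omega
    | Int.ofNat (k + 1), ha =>
      have : K ≤ k := by simp at ha; omega
      simp [ferE, hK k this]
  induction x using CliffordAlgebra.left_induction with
  | algebraMap r => exact ⟨0, fun k _ => by simp⟩
  | add x y hx hy =>
    obtain ⟨K, hK⟩ := hx
    obtain ⟨L, hL⟩ := hy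
    exact ⟨max K L, fun k hk => by
      rw [map_add, hK k (le_trans (le_max_left _ _) hk), hL k (le_trans (le_max_right _ _) hk),
        add_zero]⟩
  | ι_mul x v hx =>
    obtain ⟨K, hK⟩ := hx
    obtain ⟨L, hL⟩ := v.support.exists_nat_subset_range
    refine ⟨max K L, fun k hk => ?_⟩
    have h0 : v k = 0 := by
      by_contra hv
      have := Finset.mem_range.1 (hL (Finsupp.mem_support_iff.2 hv))
      omega
    rw [contractLeft_ι_mul, hK k (le_trans (le_max_left _ _) hk)]
    simp [h0]

end

lemma map_eventually_zero {M N : Type*} [AddCommGroup M] [Module ℂ M] [AddCommGroup N]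
    [Module ℂ N] (f : ℤ → Module.End ℂ M) (g : ℤ → Module.End ℂ N)
    (hf : (∀ x, ∃ K : ℤ, ∀ a, K < a → f a x = 0) ∨ ∀ x, ∃ K : ℤ, ∀ a, K < a → g a x = 0)
    (v : M ⊗[ℂ] N) : ∃ K : ℤ, ∀ a, K < a → TensorProduct.map (f a) (g a) v = 0 := by
  induction v with
  | zero => exact ⟨0, fun a _ => by simp⟩
  | add x y hx hy =>
    obtain ⟨K, hK⟩ := hx
    obtain ⟨L, hL⟩ := hy
    exact ⟨max K L, fun a ha => by
      rw [map_add, hK a ((le_max_left _ _).trans_lt ha), hL a ((le_max_right _ _).trans_lt ha),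
        add_zero]⟩
  | tmul x y =>
    rcases hf with hf | hg
    · obtain ⟨K, hK⟩ := hf x
      exact ⟨K, fun a ha => by rw [TensorProduct.map_tmul, hK a ha, TensorProduct.zero_tmul]⟩
    · obtain ⟨K, hK⟩ := hg y
      exact ⟨K, fun a ha => by rw [TensorProduct.map_tmul, hK a ha, TensorProduct.tmul_zero]⟩

/-- The fields, indexed by `0`, `i`, `N + i`, of an action of the generators. -/
def genField {N : ℕ} {V : Type*} (φ : Gen N → V) : Ix N → ℤ → V
  | Sum.inl _, m => φ (Gen.e m)
  | Sum.inr (Sum.inl i), m => φ (Gen.a i m)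
  | Sum.inr (Sum.inr i), m => φ (Gen.as i m)

lemma genField_comm {V : Type*} [AddCommGroup V] [Module ℂ V] {N : ℕ} {τ : ℤˣ}
    {φ : Gen N → Module.End ℂ V}
    (rel : ∀ ⦃x y⦄, AlgRel N τ x y → FreeAlgebra.lift ℂ φ x = FreeAlgebra.lift ℂ φ y)
    (r s : Ix N) (a b : ℤ) :
    genField φ r a * genField φ s b
      = eta τ r s • (genField φ s b * genField φ r a)
        + (if a + b = 0 then form r s else 0) • 1 := by
  have hs := tau_sq τ
  rcases r with _ | i | i <;> rcases s with _ | j | j <;> simp only [genField, eta, form]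
  · have := rel (AlgRel.ee a b)
    simp only [map_add, map_mul, FreeAlgebra.lift_ι_apply] at this
    rw [eq_sub_of_add_eq this]
    split_ifs <;> simp [sub_eq_add_neg, add_comm]
  · have := rel (AlgRel.ae j b a)
    simp only [map_add, map_mul, map_smul, FreeAlgebra.lift_ι_apply, map_zero] at this
    rw [eq_neg_of_add_eq_zero_left this]
    simp [smul_smul, hs]
  · have := rel (AlgRel.se j b a)
    simp only [map_add, map_mul, map_smul, FreeAlgebra.lift_ι_apply, map_zero] at this
    rw [eq_neg_of_add_eq_zero_left this]
    simp [smul_smul, hs]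
  · have := rel (AlgRel.ae i a b)
    simp only [map_add, map_mul, map_smul, FreeAlgebra.lift_ι_apply, map_zero] at this
    rw [eq_neg_of_add_eq_zero_left this]
    simp
  · have := rel (AlgRel.aa i j a b)
    simp only [map_sub, map_mul, FreeAlgebra.lift_ι_apply, map_zero] at this
    rw [sub_eq_zero.1 this]
    simp
  · have := rel (AlgRel.as i j a b)
    simp only [map_sub, map_mul, FreeAlgebra.lift_ι_apply] at this
    rw [eq_add_of_sub_eq' this, one_smul]
    congr 1
    split_ifs <;> simp_all
  · have := rel (AlgRel.se i a b)
    simp only [map_add, map_mul, map_smul, FreeAlgebra.lift_ι_apply, map_zero] at this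
    rw [eq_neg_of_add_eq_zero_left this]
    simp
  · have := rel (AlgRel.as j i b a)
    simp only [map_sub, map_mul, FreeAlgebra.lift_ι_apply] at this
    rw [eq_add_of_sub_eq' this, one_smul, add_assoc]
    symm
    refine add_eq_left.2 ?_
    rw [add_comm b a]
    rcases eq_or_ne i j with rfl | hij
    · split_ifs <;> simp_all
    · simp [hij, hij.symm]
  · have := rel (AlgRel.ss i j a b)
    simp only [map_sub, map_mul, FreeAlgebra.lift_ι_apply, map_zero] at this
    rw [sub_eq_zero.1 this]
    simp

lemma isFieldSystem_genField {V : Type*} [AddCommGroup V] [Module ℂ V] {N : ℕ} {τ : ℤˣ}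
    {φ : Gen N → Module.End ℂ V}
    (rel : ∀ ⦃x y⦄, AlgRel N τ x y → FreeAlgebra.lift ℂ φ x = FreeAlgebra.lift ℂ φ y)
    (hφ : ∀ r v, ∃ K : ℤ, ∀ a, K < a → genField φ r a v = 0) :
    IsFieldSystem (genField φ) (eta τ) form where
  comm := genField_comm rel
  eta_mul_self r s := by
    rcases r with _ | r <;> rcases s with _ | s <;> simp [eta, tau_sq]
  eta_symm r s := by
    rcases r with _ | r <;> rcases s with _ | s <;> rfl
  form_symm r s := by
    rcases r with _ | i | i <;> rcases s with _ | j | j <;> simp [eta, form]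
    · by_cases h : i = j <;> simp [h, eq_comm]
    · by_cases h : i = j <;> simp [h, eq_comm]
  eta_eq r s t := by
    rcases r with _ | i | i <;> rcases s with _ | j | j <;> simp [form] <;>
    rcases t with _ | k <;> simp [eta]
  eventually_zero := hφ

lemma isFieldSystem_genAct {N : ℕ} {τ : ℤˣ} {lam : ℂ} (hlam : lam ^ 2 = -1 / 2) :
    IsFieldSystem (V := Fock N) (genField (genAct N τ lam)) (eta τ) form := by
  refine isFieldSystem_genField (genAct_rel hlam) fun r v => ?_
  rcases r with _ | i | i
  · exact map_eventually_zero (fun _ => twist N τ) (ferE lam)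
      (Or.inr (ferE_eventually_zero lam)) v
  · exact map_eventually_zero (bosA i) (fun _ => LinearMap.id)
      (Or.inl (bosA_eventually_zero i)) v
  · exact map_eventually_zero (bosAs i) (fun _ => LinearMap.id)
      (Or.inl (bosAs_eventually_zero i)) v

/-! ### The given operators as quadratic fields -/

section
variable {V : Type*} [AddCommGroup V] [Module ℂ V] {I : Type*} {ψ : I → ℤ → Module.End ℂ V}
  {η B : I → I → ℂ} {A : Type*} [Ring A] [Algebra ℂ A] (φ : A →ₐ[ℂ] Module.End ℂ V)
  {u v : ℤ → A} {r s : I}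

/-- Away from `a + b = 0` the modes commute up to `ε` and all three cases of `nord` agree. On `a + b
= 0` the comparison of `a` with `b` is the sign of `a`, so the cases match the values `0`, `1/2`,
`1` of the step function. -/
lemma IsFieldSystem.map_nord (h : IsFieldSystem ψ η B) {ε : ℤ} (hε : η r s = ε)
    (hu : ∀ k, φ (u k) = ψ r k) (hv : ∀ k, φ (v k) = ψ s k) (a b : ℤ) :
    φ (nord ε u v a b) = normalProd ψ B r s a b := by
  have hc := h.comm r s a b
  rw [hε, Int.cast_smul_eq_zsmul] at hc
  unfold nord normalProd
  rw [apply_ite φ, apply_ite φ]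
  simp only [map_smul, map_add, map_mul, map_zsmul, hu, hv]
  rw [eq_sub_of_add_eq hc.symm]
  rcases lt_trichotomy a b with h | h | h
  · rw [if_pos h]
    have : (if a + b = 0 then B r s * hstep a else 0) = 0 := by
      unfold hstep
      split_ifs <;> first | omega | simp
    rw [this, zero_smul, sub_zero]
  · rw [if_neg h.not_lt, if_pos h]
    have : (if a + b = 0 then B r s * hstep a else 0)
        = 1 / 2 * (if a + b = 0 then B r s else 0) := by
      unfold hstep
      split_ifs <;> first | omega | ring
    rw [this]
    module
  · rw [if_neg h.not_gt, if_neg h.ne']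
    have : (if a + b = 0 then B r s * hstep a else 0)
        = if a + b = 0 then B r s else 0 := by
      unfold hstep
      split_ifs <;> first | omega | ring
    rw [this]

lemma map_mul_eq_normalProd (hB : B r s = 0) {x y : A} {a b : ℤ} (hx : φ x = ψ r a)
    (hy : φ y = ψ s b) : φ (x * y) = normalProd ψ B r s a b := by
  simp [normalProd, hx, hy, hB]

lemma shift_eq (q : ℂˣ) (m n : ℤ) : shift q m n = if m = 0 then shift q 0 n else 0 := by
  unfold shift
  split_ifs <;> simp_all

/-- `quadShift` subtracts `B` times the shift. As `form` is `-1` on the pairs `(i, N + i)` and `(0,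
0)`, this is the addition of `σ` in `F` and `E_0`. -/
lemma locSum_add_shift {q : ℂˣ} {m n : ℤ} {t : ℤ → Module.End ℂ V} (ht : t = quadTerm ψ B q r s m n)
    {c : ℂ} (hc : c = -(B r s * shift q m n)) : locSum t + c • 1 = quadShift ψ B q r s m n := by
  rw [quadShift, quad, ht, hc, shift_eq, neg_smul, ← sub_eq_add_neg, mul_ite, mul_zero]

lemma locSum_eq_quadShift {q : ℂˣ} {m n : ℤ} {t : ℤ → Module.End ℂ V}
    (ht : t = quadTerm ψ B q r s m n) (hB : B r s = 0) : locSum t = quadShift ψ B q r s m n := by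
  simp [quadShift, quad, ht, hB]

end

section
variable {N : ℕ} {q : ℂˣ} {τ : ℤˣ} {lam : ℂ} {hlam : lam ^ 2 = -1 / 2}

lemma fockRep_gen (x : Gen N) : fockRep N τ lam hlam (gen τ x) = genAct N τ lam x := by
  unfold fockRep gen
  rw [RingQuot.liftAlgHom_mkAlgHom_apply, FreeAlgebra.lift_ι_apply]

lemma fTerm_eq (i j : Fin N) (m n : ℤ) : fTerm N q τ lam hlam i j m n
    = quadTerm (V := Fock N) (genField (genAct N τ lam)) form q (iA i) (iB j) m n :=
  funext fun _ => congrArg _ ((isFieldSystem_genAct hlam).map_nord (V := Fock N)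
    (fockRep N τ lam hlam) (by simp [eta, iA, iB]) (fun _ => fockRep_gen _)
      (fun _ => fockRep_gen _) _ _)

lemma gTerm_eq (i j : Fin N) (m n : ℤ) : gTerm N q τ lam hlam i j m n
    = quadTerm (V := Fock N) (genField (genAct N τ lam)) form q (iA i) (iA j) m n :=
  funext fun _ => congrArg _ ((isFieldSystem_genAct hlam).map_nord (V := Fock N)
    (fockRep N τ lam hlam) (by simp [eta, iA]) (fun _ => fockRep_gen _)
      (fun _ => fockRep_gen _) _ _)

lemma hTerm_eq (i j : Fin N) (m n : ℤ) : hTerm N q τ lam hlam i j m n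
    = quadTerm (V := Fock N) (genField (genAct N τ lam)) form q (iB i) (iB j) m n :=
  funext fun _ => congrArg _ ((isFieldSystem_genAct hlam).map_nord (V := Fock N)
    (fockRep N τ lam hlam) (by simp [eta, iB]) (fun _ => fockRep_gen _)
      (fun _ => fockRep_gen _) _ _)

lemma eTerm_eq (i : Fin N) (m n : ℤ) : eTerm N q τ lam hlam i m n
    = quadTerm (V := Fock N) (genField (genAct N τ lam)) form q (iA i) (i0 N) m n :=
  funext fun k => congrArg (fun T : Module.End ℂ (Fock N) => qpow q (-(n * k)) • T)
    (map_mul_eq_normalProd (V := Fock N) (ψ := genField (genAct N τ lam)) (B := form)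
      (r := iA i) (s := i0 N) (a := m - k) (b := k) (fockRep N τ lam hlam) rfl
      (fockRep_gen (Gen.a i (m - k))) (fockRep_gen (Gen.e k)))

lemma esTerm_eq (i : Fin N) (m n : ℤ) : esTerm N q τ lam hlam i m n
    = quadTerm (V := Fock N) (genField (genAct N τ lam)) form q (iB i) (i0 N) m n :=
  funext fun k => congrArg (fun T : Module.End ℂ (Fock N) => qpow q (-(n * k)) • T)
    (map_mul_eq_normalProd (V := Fock N) (ψ := genField (genAct N τ lam)) (B := form)
      (r := iB i) (s := i0 N) (a := m - k) (b := k) (fockRep N τ lam hlam) rfl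
      (fockRep_gen (Gen.as i (m - k))) (fockRep_gen (Gen.e k)))

lemma e0Term_eq (m n : ℤ) : e0Term N q τ lam hlam m n
    = quadTerm (V := Fock N) (genField (genAct N τ lam)) form q (i0 N) (i0 N) m n :=
  funext fun _ => congrArg _ ((isFieldSystem_genAct hlam).map_nord (V := Fock N)
    (fockRep N τ lam hlam) (by simp [eta, i0]) (fun _ => fockRep_gen _)
      (fun _ => fockRep_gen _) _ _)

lemma allLocFin : AllLocFin N q τ lam hlam := by
  have h := (isFieldSystem_genAct hlam (N := N) (τ := τ)).locFin_quadTerm q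
  refine ⟨fun i j m n => ?_, fun i j m n => ?_, fun i j m n => ?_, fun i m n => ?_,
    fun i m n => ?_, fun m n => ?_⟩
  · rw [fTerm_eq]; exact h _ _ _ _
  · rw [gTerm_eq]; exact h _ _ _ _
  · rw [hTerm_eq]; exact h _ _ _ _
  · rw [eTerm_eq]; exact h _ _ _ _
  · rw [esTerm_eq]; exact h _ _ _ _
  · rw [e0Term_eq]; exact h _ _ _ _

lemma opF_eq (i j : Fin N) (m n : ℤ) : opF N q τ lam hlam i j m n
    = quadShift (V := Fock N) (genField (genAct N τ lam)) form q (iA i) (iB j) m n :=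
  locSum_add_shift (V := Fock N) (fTerm_eq i j m n) (by simp only [form, iA, iB]; split_ifs <;> simp)

lemma opE0_eq (m n : ℤ) : opE0 N q τ lam hlam m n
    = quadShift (V := Fock N) (genField (genAct N τ lam)) form q (i0 N) (i0 N) m n :=
  locSum_add_shift (V := Fock N) (e0Term_eq m n) (by simp [form, i0])

lemma opG_eq (i j : Fin N) (m n : ℤ) : opG N q τ lam hlam i j m n
    = quadShift (V := Fock N) (genField (genAct N τ lam)) form q (iA i) (iA j) m n :=
  locSum_eq_quadShift (V := Fock N) (gTerm_eq i j m n) rfl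

lemma opH_eq (i j : Fin N) (m n : ℤ) : opH N q τ lam hlam i j m n
    = quadShift (V := Fock N) (genField (genAct N τ lam)) form q (iB i) (iB j) m n :=
  locSum_eq_quadShift (V := Fock N) (hTerm_eq i j m n) rfl

lemma opE_eq (i : Fin N) (m n : ℤ) : opE N q τ lam hlam i m n
    = quadShift (V := Fock N) (genField (genAct N τ lam)) form q (iA i) (i0 N) m n :=
  locSum_eq_quadShift (V := Fock N) (eTerm_eq i m n) rfl

lemma opEs_eq (i : Fin N) (m n : ℤ) : opEs N q τ lam hlam i m n
    = quadShift (V := Fock N) (genField (genAct N τ lam)) form q (iB i) (i0 N) m n :=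
  locSum_eq_quadShift (V := Fock N) (esTerm_eq i m n) rfl

end

/-! ### The symmetry of the matrices in `S` -/

section
variable {N : ℕ}

/-- The involution `0 ↦ 0`, `i ↔ N + i` of the indices. -/
def dual : Ix N → Ix N
  | Sum.inl u => Sum.inl u
  | Sum.inr (Sum.inl i) => Sum.inr (Sum.inr i)
  | Sum.inr (Sum.inr i) => Sum.inr (Sum.inl i)

lemma dual_involutive : Function.Involutive (dual (N := N)) := by
  rintro (u | i | i) <;> rfl

@[simp] lemma dual_dual (r : Ix N) : dual (dual r) = r := dual_involutive r

lemma dual_eq_iff {r s : Ix N} : dual r = s ↔ r = dual s := dual_involutive.eq_iff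

lemma par_dual (r : Ix N) : par (dual r) = par r := by
  rcases r with u | i | i <;> rfl

/-- The sign of the row `r` of `G`. -/
def rowSign : Ix N → ℂ
  | Sum.inl _ => 1
  | Sum.inr (Sum.inl _) => 1
  | Sum.inr (Sum.inr _) => -1

/-- The coefficient of the first field in the operator of a matrix unit. -/
def leftCoeff (τ : ℤˣ) : Ix N → ℂ
  | Sum.inl _ => 1
  | Sum.inr (Sum.inl _) => ((τ : ℤ) : ℂ)
  | Sum.inr (Sum.inr _) => -1

/-- The coefficient of the second field in the operator of a matrix unit. -/
def rightCoeff (τ : ℤˣ) : Ix N → ℂ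
  | Sum.inl _ => -1
  | Sum.inr (Sum.inl _) => ((τ : ℤ) : ℂ)
  | Sum.inr (Sum.inr _) => 1

/-- The sign with which `x ^ m y ^ n e_{tw}` and its image under the involution with fixed points
`S` are related. -/
def symSign (τ : ℤˣ) (t w : Ix N) : ℂ :=
  leftCoeff τ t * rightCoeff τ w * (leftCoeff τ (dual w) * rightCoeff τ (dual t)) * eta τ t w

variable {q : ℂˣ}

lemma Gmat_apply (k l : Ix N) :
    Gmat N q k l = if l = dual k then rowSign k • (1 : QTorus q) else 0 := by
  rcases k with k | k | k <;> rcases l with l | l | l <;>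
    simp [Gmat, dual, rowSign, Matrix.one_apply, eq_comm (a := l)]
  split_ifs <;> simp

lemma Gmat_mul_apply (Y : Mat N q) (k l : Ix N) :
    (Gmat N q * Y) k l = rowSign k • Y (dual k) l := by
  simp [Matrix.mul_apply, Gmat_apply]

lemma conjTranspose_mul_Gmat_apply (Y : Mat N q) (k l : Ix N) :
    (Yᴴ * Gmat N q) k l = rowSign (dual l) • bar q (Y (dual l) k) := by
  simp [Matrix.mul_apply, Gmat_apply, Matrix.conjTranspose_apply, star_def, ← dual_eq_iff]

lemma Jmat_mul_apply (Y : Mat N q) (k l : Ix N) :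
    (Jmat N q * Y) k l = strSgn k • Y k l := by
  have hJ : Jmat N q = Matrix.diagonal (Sum.elim (fun _ => 1) (fun _ => -1)) := by
    simp [Jmat, ← Matrix.fromBlocks_diagonal, ← Matrix.diagonal_neg]
  rw [hJ, Matrix.diagonal_mul]
  rcases k with k | k <;> simp [strSgn, par]

lemma apply_eq_zero_of_part_eq {α : ZMod 2} {X : Mat N q} (hX : part α X = X) {i j : Ix N}
    (h : par i + par j ≠ α) : X i j = 0 := by
  rw [← hX]
  simp [part, h]

lemma part_eq_zero_of_ne {α β : ZMod 2} (hαβ : β ≠ α) {X : Mat N q} (hX : part α X = X) :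
    part β X = 0 := by
  ext i j : 2
  simp only [part, Matrix.of_apply, Matrix.zero_apply]
  split_ifs with h
  · exact apply_eq_zero_of_part_eq hX (h ▸ hαβ)
  · rfl

lemma rowSign_mul_self (k : Ix N) : rowSign k * rowSign k = 1 := by
  rcases k with k | k | k <;> simp [rowSign]

/-- Entrywise form of the equations of `S`. The even and the odd equation carry different signs, but
on entries of the corresponding parity both agree with `symSign`, for either value of `τ`. -/
lemma apply_dual_of_mem_SS (τ : ℤˣ) {Y : Mat N q} (hY : Y ∈ SS N q) {β : ZMod 2}
    (hβ : part β Y = Y) (t w : Ix N) :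
    Y (dual w) (dual t) = symSign τ t w • bar q (Y t w) := by
  by_cases hp : par t + par w = β
  swap
  · have h1 : par (dual w) + par (dual t) ≠ β := by rwa [par_dual, par_dual, add_comm]
    simp [apply_eq_zero_of_part_eq hβ hp, apply_eq_zero_of_part_eq hβ h1]
  have hs := tau_sq τ
  obtain ⟨h0, h1⟩ := hY
  have e0 := congrFun (congrFun h0 w) (dual t)
  have e1 := congrFun (congrFun h1 w) (dual t)
  rw [Matrix.add_apply, conjTranspose_mul_Gmat_apply, Gmat_mul_apply, dual_dual,
    Matrix.zero_apply] at e0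
  rw [Matrix.sub_apply, conjTranspose_mul_Gmat_apply, mul_assoc, Jmat_mul_apply, Gmat_mul_apply,
    dual_dual, Matrix.zero_apply] at e1
  rcases (by decide : ∀ β : ZMod 2, β = 0 ∨ β = 1) β with rfl | rfl
  · rw [hβ] at e0
    have : Y (dual w) (dual t) = -(rowSign w * rowSign t) • bar q (Y t w) := by
      have := rowSign_mul_self w
      linear_combination (norm := module) rowSign w • e0 - this • Y (dual w) (dual t)
    rw [this]
    congr 1
    -- A sign table over the types of the two indices; `hp` discards the pairs of the wrong parity.
    rcases t with t | t | t <;> rcases w with w | w | w <;>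
      simp [par, rowSign, symSign, leftCoeff, rightCoeff, dual, eta, hs] at hp ⊢
  · rw [hβ] at e1
    have : Y (dual w) (dual t) = ((strSgn w : ℂ) * rowSign w * rowSign t) • bar q (Y t w) := by
      have h2 := rowSign_mul_self w
      have h3 : (strSgn w : ℂ) * strSgn w = 1 := by
        rcases w with w | w <;> simp [strSgn, par]
      rw [← Int.cast_smul_eq_zsmul ℂ] at e1
      have h4 : (strSgn w : ℂ) * rowSign w * (strSgn w * rowSign w) = 1 := by
        linear_combination rowSign w * rowSign w * h3 + h2
      linear_combination (norm := module) (-(strSgn w : ℂ) * rowSign w) • e1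
        - h4 • Y (dual w) (dual t)
    rw [this]
    congr 1
    rcases t with t | t | t <;> rcases w with w | w | w <;>
      simp [par, rowSign, symSign, leftCoeff, rightCoeff, dual, eta, hs, strSgn] at hp ⊢

/-! ### The operator of a matrix -/

variable {τ : ℤˣ}

lemma leftCoeff_sq (r : Ix N) : leftCoeff τ r * leftCoeff τ r = 1 := by
  rcases r with r | r | r <;> simp [leftCoeff, tau_sq]

lemma rightCoeff_sq (r : Ix N) : rightCoeff τ r * rightCoeff τ r = 1 := by
  rcases r with r | r | r <;> simp [rightCoeff, tau_sq]

lemma eta_dual_left (r s : Ix N) : eta τ (dual r) s = eta τ r s := by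
  rcases r with r | r | r <;> rcases s with s | s <;> rfl

lemma eta_dual_right (r s : Ix N) : eta τ r (dual s) = eta τ r s := by
  rcases s with s | s | s <;> rcases r with r | r <;> rfl

lemma eta_self (r : Ix N) : eta τ r r = -(strSgn r : ℂ) := by
  rcases r with r | r <;> simp [eta, strSgn, par]

/-- The colour factor of two quadratic fields is the super sign of the matrix units: the mixed
factors `-τ` occur an even number of times, so `τ` disappears. -/
lemma sgn_eq (r s t w : Ix N) : (sgn (par r + par s) (par t + par w) : ℂ)
    = eta τ r t * eta τ s t * (eta τ r w * eta τ s w) := by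
  have h : (1 : ZMod 2) + 1 = 0 := rfl
  rcases r with r | r <;> rcases s with s | s <;> rcases t with t | t <;> rcases w with w | w <;>
    simp [sgn, par, eta, h, tau_sq]

end

section
variable {N : ℕ} {q : ℂˣ} {τ : ℤˣ} {V : Type*} [AddCommGroup V] [Module ℂ V]
  {ψ : Ix N → ℤ → Module.End ℂ V}

/-- The operator of `u e_{rs}`. -/
def unitOp (τ : ℤˣ) (ψ : Ix N → ℤ → Module.End ℂ V) (q : ℂˣ) (r s : Ix N) :
    QTorus q →ₗ[ℂ] Module.End ℂ V :=
  (leftCoeff τ r * rightCoeff τ s) • quadLin ψ form q r (dual s)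

/-- The operator of a matrix. -/
def matOp (τ : ℤˣ) (ψ : Ix N → ℤ → Module.End ℂ V) (q : ℂˣ) :
    Mat N q →ₗ[ℂ] Module.End ℂ V :=
  ∑ r, ∑ s, unitOp τ ψ q r s ∘ₗ Matrix.entryLinearMap ℂ (QTorus q) r s

lemma matOp_apply (X : Mat N q) : matOp τ ψ q X = ∑ r, ∑ s, unitOp τ ψ q r s (X r s) := by
  simp [matOp]

lemma matOp_single (r s : Ix N) (u : QTorus q) :
    matOp τ ψ q (Matrix.single r s u) = unitOp τ ψ q r s u := by
  rw [matOp_apply, Finset.sum_eq_single r, Finset.sum_eq_single s]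
  · simp
  · intro s' _ hs'
    rw [Matrix.single_apply_of_col_ne _ _ hs'.symm, map_zero]
  · simp
  · intro r' _ hr'
    refine Finset.sum_eq_zero fun s' _ => ?_
    rw [Matrix.single_apply_of_row_ne hr'.symm, map_zero]
  · simp

/-- The contribution of the entries `u e_{rs}` and `v e_{tw}` to the operator of the bracket with
sign `ε` in the central extension. -/
def pairOp (τ : ℤˣ) (ψ : Ix N → ℤ → Module.End ℂ V) (ε : ℂ) (r s t w : Ix N) (u v : QTorus q) :
    Module.End ℂ V :=
  (if s = t then unitOp τ ψ q r w (u * v) else 0)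
    - (if r = w then ε • unitOp τ ψ q t s (v * u) else 0)
    + (if s = t then if r = w then ((strSgn r : ℂ) * kapLin q u v) • 1 else 0 else 0)

lemma sum_pairOp (ε : ℂ) (X Y : Mat N q) :
    ∑ r, ∑ s, ∑ t, ∑ w, pairOp τ ψ ε r s t w (X r s) (Y t w)
      = matOp τ ψ q (X * Y) - ε • matOp τ ψ q (Y * X)
        + (∑ i, ∑ j, (strSgn i : ℂ) * kapLin q (X i j) (Y j i)) • 1 := by
  simp only [pairOp, Finset.sum_add_distrib, Finset.sum_sub_distrib]
  congr 1
  · congr 1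
    · rw [matOp_apply]
      refine Finset.sum_congr rfl fun r _ => ?_
      have (s : Ix N) : ∑ t, ∑ w, (if s = t then unitOp τ ψ q r w (X r s * Y t w) else 0)
          = ∑ w, unitOp τ ψ q r w (X r s * Y s w) := by
        rw [Finset.sum_comm]
        simp
      simp only [this, Matrix.mul_apply, map_sum]
      exact Finset.sum_comm
    · rw [matOp_apply]
      simp only [Finset.sum_ite_eq, Finset.mem_univ, if_true, Matrix.mul_apply, map_sum,
        Finset.smul_sum]
      rw [Finset.sum_comm' (t' := Finset.univ) (s' := fun _ => Finset.univ) (by simp)]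
      rw [Finset.sum_congr rfl fun s _ => Finset.sum_comm]
      exact Finset.sum_comm
  · rw [Finset.sum_smul]
    refine Finset.sum_congr rfl fun r _ => ?_
    rw [Finset.sum_smul]
    refine Finset.sum_congr rfl fun s _ => ?_
    rw [Finset.sum_comm]
    simp

/-- Multiplied by the two coefficients, the contraction of the second field of `e_{rs}` with the
first field of `e_{tw}` is `δ_{st}`, as in `e_{rs} e_{tw} = δ_{st} e_{rw}`. This property dictates
the choice of `leftCoeff` and `rightCoeff`. -/
lemma form_dual_left (τ : ℤˣ) (s t : Ix N) :
    form (dual s) t = if s = t then rightCoeff τ s * leftCoeff τ s else 0 := by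
  rcases s with s | s | s <;> rcases t with t | t | t <;>
    simp [rightCoeff, leftCoeff, form, dual, tau_sq]

/-- The contraction of the outer fields yields `δ_{rw}` with an extra `strSgn`; this is the origin
of the supertrace in the central term. -/
lemma form_dual_right (τ : ℤˣ) (r w : Ix N) :
    form r (dual w) = if r = w then leftCoeff τ r * rightCoeff τ r * strSgn r else 0 := by
  rcases r with r | r | r <;> rcases w with w | w | w <;>
    simp [rightCoeff, leftCoeff, form, dual, strSgn, par, tau_sq]

lemma form_eq_ite (τ : ℤˣ) (r t : Ix N) :
    form r t = if r = dual t then leftCoeff τ r * rightCoeff τ r * strSgn r else 0 := by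
  rw [← form_dual_right, dual_dual]

lemma form_dual_dual (τ : ℤˣ) (s w : Ix N) :
    form (dual s) (dual w) = if s = dual w then rightCoeff τ s * leftCoeff τ s else 0 :=
  form_dual_left τ s (dual w)

lemma eta_mul_self' (r s : Ix N) : eta τ r s * eta τ r s = 1 := by
  rcases r with _ | r <;> rcases s with _ | s <;> simp [eta, tau_sq]

lemma eta_comm (r s : Ix N) : eta τ r s = eta τ s r := by
  rcases r with _ | r <;> rcases s with _ | s <;> rfl

lemma strSgn_dual (r : Ix N) : strSgn (dual r) = strSgn r := by
  rw [strSgn, par_dual, strSgn]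

/-- Contractions of `s` with `t` and of `r` with `w` give the superbracket of the two matrix units.
The remaining two, of `r` with `t` and of `s` with `w`, give the superbracket with the dual unit
`e_{dual w, dual t}`. -/
lemma unitOp_comm (h : IsFieldSystem ψ (eta τ) form) (r s t w : Ix N) (u v : QTorus q) :
    unitOp τ ψ q r s u * unitOp τ ψ q t w v
        - (sgn (par r + par s) (par t + par w) : ℂ) • (unitOp τ ψ q t w v * unitOp τ ψ q r s u)
      = pairOp τ ψ (sgn (par r + par s) (par t + par w)) r s t w u v
        + pairOp τ ψ (sgn (par r + par s) (par t + par w)) r s (dual w) (dual t) u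
            (symSign τ t w • bar q v) := by
  have hc := h.quadLin_comm q r (dual s) t (dual w) u v
  simp only [eta_dual_left, eta_dual_right] at hc
  -- The two crossed terms are rewritten so that `bar` falls on `v` alone, as the bracket with the
  -- dual unit requires.
  rw [h.quadLin_swap q (dual s) (dual w), h.quadLin_swap q t r, bar_mul, bar_mul, bar_bar,
    kapLin_bar] at hc
  rw [sgn_eq (τ := τ)]
  have e := eta_comm (τ := τ) (N := N)
  have l2 := leftCoeff_sq (τ := τ) (N := N)
  have r2 := rightCoeff_sq (τ := τ) (N := N)
  have e2 := eta_mul_self' (τ := τ) (N := N)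
  -- Coefficients of the four quadratic terms (`K1` to `K4`) and of the two scalars (`K5`, `K6`).
  -- `K1`, `K4`, `K5` belong to the pair itself; `K2`, `K3`, `K6` to the dual pair.
  have K1 : leftCoeff τ r * rightCoeff τ s * (leftCoeff τ t * rightCoeff τ w) * form (dual s) t
      = if s = t then leftCoeff τ r * rightCoeff τ w else 0 := by
    rw [form_dual_left τ]
    split_ifs with hst
    · subst hst
      linear_combination leftCoeff τ r * rightCoeff τ w *
        (leftCoeff τ s * leftCoeff τ s * r2 s + l2 s)
    · simp
  have K4 : leftCoeff τ r * rightCoeff τ s * (leftCoeff τ t * rightCoeff τ w) *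
      (eta τ r t * eta τ s t * (eta τ s w * form r (dual w)))
      = - if r = w then (eta τ r t * eta τ s t * (eta τ r w * eta τ s w)) *
        (leftCoeff τ t * rightCoeff τ s) else 0 := by
    rw [form_dual_right τ]
    split_ifs with hrw
    · subst hrw
      rw [eta_self]
      linear_combination rightCoeff τ s * leftCoeff τ t * eta τ r t * eta τ s t * eta τ s r *
        strSgn r * (leftCoeff τ r * leftCoeff τ r * r2 r + l2 r)
    · simp
  have K5 : leftCoeff τ r * rightCoeff τ s * (leftCoeff τ t * rightCoeff τ w) *
      (form (dual s) t * form r (dual w) * kapLin q u v)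
      = if s = t then if r = w then (strSgn r : ℂ) * kapLin q u v else 0 else 0 := by
    rw [form_dual_left τ, form_dual_right τ]
    split_ifs with hst hrw
    · subst hst hrw
      linear_combination strSgn r * kapLin q u v * (leftCoeff τ s * leftCoeff τ s * leftCoeff τ r * leftCoeff τ r *
        rightCoeff τ r * rightCoeff τ r * r2 s + leftCoeff τ r * leftCoeff τ r *
        rightCoeff τ r * rightCoeff τ r * l2 s + rightCoeff τ r * rightCoeff τ r * l2 r + r2 r)
    all_goals simp
  have K3 : leftCoeff τ r * rightCoeff τ s * (leftCoeff τ t * rightCoeff τ w) *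
      (eta τ r t * eta τ s t * form (dual s) (dual w) * eta τ t r)
      = if s = dual w then symSign τ t w * (leftCoeff τ r * rightCoeff τ (dual t)) else 0 := by
    rw [form_dual_dual τ, symSign]
    split_ifs with hsw
    · subst hsw
      rw [eta_dual_left, e t r, e w t]
      linear_combination leftCoeff τ r * leftCoeff τ t * rightCoeff τ w * leftCoeff τ (dual w) *
        eta τ t w * (eta τ r t * eta τ r t * r2 (dual w) + e2 r t - r2 (dual t))
    · simp
  have K2 : leftCoeff τ r * rightCoeff τ s * (leftCoeff τ t * rightCoeff τ w) *
      (eta τ s t * form r t * eta τ s w)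
      = - if r = dual t then (eta τ r t * eta τ s t * (eta τ r w * eta τ s w)) *
        (symSign τ t w * (leftCoeff τ (dual w) * rightCoeff τ s)) else 0 := by
    rw [form_eq_ite τ, symSign]
    split_ifs with hrt
    · subst hrt
      simp only [eta_dual_left]
      rw [eta_self, strSgn_dual]
      linear_combination rightCoeff τ s * leftCoeff τ t * rightCoeff τ w * rightCoeff τ (dual t) *
        strSgn t * eta τ s t * eta τ s w *
        (l2 (dual t) - eta τ t w * eta τ t w * l2 (dual w) - e2 t w)
    · simp
  have K6 : leftCoeff τ r * rightCoeff τ s * (leftCoeff τ t * rightCoeff τ w) *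
      (eta τ s t * form r t * form (dual s) (dual w) * kapLin q u (bar q v))
      = if s = dual w then if r = dual t then
        (strSgn r : ℂ) * (symSign τ t w * kapLin q u (bar q v)) else 0 else 0 := by
    rw [form_eq_ite τ, form_dual_dual τ, symSign]
    split_ifs with hsw hrt
    · subst hsw hrt
      rw [eta_dual_left, e w t]
      linear_combination leftCoeff τ t * rightCoeff τ w * eta τ t w * rightCoeff τ (dual t) *
        strSgn (dual t) * leftCoeff τ (dual w) * kapLin q u (bar q v) *
        (rightCoeff τ (dual w) * rightCoeff τ (dual w) * l2 (dual t) + r2 (dual w))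
    all_goals simp
  have ite_s (P : Prop) [Decidable P] (a : ℂ) (x : Module.End ℂ V) :
      (if P then a • x else 0) = (if P then a else 0) • x := by
    split_ifs <;> simp
  simp only [pairOp, unitOp, LinearMap.smul_apply, dual_dual, mul_smul_comm, smul_mul_assoc,
    map_smul, smul_smul, smul_eq_mul, ite_s] at hc ⊢
  simp only [eta_dual_left, eta_dual_right] at hc
  linear_combination (norm := module)
    (leftCoeff τ r * rightCoeff τ s * (leftCoeff τ t * rightCoeff τ w)) • hc
    + K1 • quadLin ψ form q r (dual w) (u * v)
    + K2 • quadLin ψ form q (dual w) (dual s) (bar q v * u)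
    + K3 • quadLin ψ form q r t (u * bar q v)
    + K4 • quadLin ψ form q t (dual s) (v * u)
    + K5 • (1 : Module.End ℂ V)
    + K6 • (1 : Module.End ℂ V)


lemma sum_dual {M : Type*} [AddCommMonoid M] (f : Ix N → Ix N → M) :
    ∑ t, ∑ w, f (dual w) (dual t) = ∑ t, ∑ w, f t w := by
  rw [Finset.sum_comm]
  exact (Equiv.sum_comp dual_involutive.toPerm fun y => ∑ x, f y (dual x)).trans
    (Finset.sum_congr rfl fun y _ => Equiv.sum_comp dual_involutive.toPerm (f y))

/-- Since `Y` lies in `S`, its entries absorb `symSign` and `bar`, and the sum over dual pairs is a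
reindexing of the sum over pairs. Hence the factor `2`. -/
lemma matOp_comm (h : IsFieldSystem ψ (eta τ) form) {α β : ZMod 2} {X Y : Mat N q}
    (hX : part α X = X) (hY : part β Y = Y) (hYS : Y ∈ SS N q) :
    matOp τ ψ q X * matOp τ ψ q Y - (sgn α β : ℂ) • (matOp τ ψ q Y * matOp τ ψ q X)
      = (2 : ℂ) • (matOp τ ψ q (X * Y) - (sgn α β : ℂ) • matOp τ ψ q (Y * X)
        + (∑ i, ∑ j, (strSgn i : ℂ) * kapLin q (X i j) (Y j i)) • 1) := by
  have key (r s t w : Ix N) : unitOp τ ψ q r s (X r s) * unitOp τ ψ q t w (Y t w)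
      - (sgn α β : ℂ) • (unitOp τ ψ q t w (Y t w) * unitOp τ ψ q r s (X r s))
      = pairOp τ ψ (sgn α β) r s t w (X r s) (Y t w)
        + pairOp τ ψ (sgn α β) r s (dual w) (dual t) (X r s) (Y (dual w) (dual t)) := by
    rw [apply_dual_of_mem_SS τ hYS hY]
    by_cases h1 : par r + par s = α
    · by_cases h2 : par t + par w = β
      · rw [← h1, ← h2]
        exact unitOp_comm h r s t w (X r s) (Y t w)
      · simp [apply_eq_zero_of_part_eq hY h2, pairOp]
    · simp [apply_eq_zero_of_part_eq hX h1, pairOp]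
  have e1 : matOp τ ψ q X * matOp τ ψ q Y - (sgn α β : ℂ) • (matOp τ ψ q Y * matOp τ ψ q X)
      = ∑ r, ∑ s, ∑ t, ∑ w, (unitOp τ ψ q r s (X r s) * unitOp τ ψ q t w (Y t w)
      - (sgn α β : ℂ) • (unitOp τ ψ q t w (Y t w) * unitOp τ ψ q r s (X r s))) := by
    rw [matOp_apply X]
    simp only [Finset.sum_mul, Finset.mul_sum, Finset.smul_sum]
    rw [← Finset.sum_sub_distrib]
    refine Finset.sum_congr rfl fun r _ => ?_
    rw [← Finset.sum_sub_distrib]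
    refine Finset.sum_congr rfl fun s _ => ?_
    rw [matOp_apply Y]
    simp only [Finset.sum_mul, Finset.mul_sum, Finset.smul_sum, Finset.sum_sub_distrib]
  have e2 : ∑ r, ∑ s, ∑ t, ∑ w,
        pairOp τ ψ (sgn α β) r s (dual w) (dual t) (X r s) (Y (dual w) (dual t))
      = ∑ r, ∑ s, ∑ t, ∑ w, pairOp τ ψ (sgn α β) r s t w (X r s) (Y t w) := by
    refine Finset.sum_congr rfl fun r _ => Finset.sum_congr rfl fun s _ => ?_
    exact sum_dual (fun t w => pairOp τ ψ (sgn α β) r s t w (X r s) (Y t w))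
  rw [e1, ← sum_pairOp, two_smul]
  simp only [key, Finset.sum_add_distrib]
  rw [e2]

end

/-! ### The operators of the central extension -/

section
variable {N : ℕ} {q : ℂˣ} {τ : ℤˣ} {V : Type*} [AddCommGroup V] [Module ℂ V]
  {ψ : Ix N → ℤ → Module.End ℂ V}

/-- The sum of the coefficients of the `c(n)`. -/
def centralSum (q : ℂˣ) : (Lam q →₀ ℂ) →ₗ[ℂ] ℂ := Finsupp.linearCombination ℂ fun _ => 1

/-- All `c(n)` act by the same scalar, so only the total coefficient of the cocycle matters. -/
lemma centralSum_kap (u v : QTorus q) : centralSum q (kap q u v) = kapLin q u v := by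
  have : (kap q).compr₂ (centralSum q) = kapLin q := by
    refine lin_ext fun m n => lin_ext fun p l => ?_
    simp only [LinearMap.compr₂_apply, kap, kapLin, lin_mono, kapSum]
    split_ifs with h
    · exact (Finsupp.linearCombination_single ℂ _ _).trans (by rw [smul_eq_mul, mul_one])
    · simp
  exact congrArg (fun L => L u v) this

/-- The operator of an element of the central extension. -/
def hatOp (τ : ℤˣ) (ψ : Ix N → ℤ → Module.End ℂ V) (q : ℂˣ) : Hat N q →ₗ[ℂ] Module.End ℂ V :=
  (1 / 2 : ℂ) • (matOp τ ψ q ∘ₗ LinearMap.fst ℂ _ _ +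
    (centralSum q ∘ₗ LinearMap.fst ℂ _ _ ∘ₗ LinearMap.snd ℂ _ _).smulRight 1)

lemma hatOp_apply (x : Hat N q) :
    hatOp τ ψ q x = (1 / 2 : ℂ) • (matOp τ ψ q x.1 + centralSum q x.2.1 • 1) := rfl

lemma sBracket_of_homog {α β : ZMod 2} {X Y : Mat N q} (hX : part α X = X) (hY : part β Y = Y) :
    sBracket X Y = X * Y - sgn α β • (Y * X) := by
  rw [sBracket, Finset.sum_eq_single α, Finset.sum_eq_single β, hX, hY]
  · intro γ _ hγ
    simp [part_eq_zero_of_ne hγ hY]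
  · simp
  · intro γ _ hγ
    simp [part_eq_zero_of_ne hγ hX]
  · simp

lemma hatOp_hatBracket (h : IsFieldSystem ψ (eta τ) form) {α β : ZMod 2} {x y : Hat N q}
    (hx : HatHomog α x) (hy : HatHomog β y) (hyS : y.1 ∈ SS N q) :
    hatOp τ ψ q (hatBracket x y)
      = hatOp τ ψ q x * hatOp τ ψ q y - sgn α β • (hatOp τ ψ q y * hatOp τ ψ q x) := by
  have hc := matOp_comm h hx.1 hy.1 hyS
  have hb : matOp τ ψ q (hatBracket x y).1
      = matOp τ ψ q (x.1 * y.1) - (sgn α β : ℂ) • matOp τ ψ q (y.1 * x.1) := by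
    rw [hatBracket, sBracket_of_homog hx.1 hy.1, map_sub, map_zsmul, Int.cast_smul_eq_zsmul]
  have hk : centralSum q (hatBracket x y).2.1
      = ∑ i, ∑ j, (strSgn i : ℂ) * kapLin q (x.1 i j) (y.1 j i) := by
    simp only [hatBracket, map_sum, map_zsmul, centralSum_kap, zsmul_eq_mul]
  -- An element with a nonzero central component is even, so the super sign is invisible to it; this
  -- cancels the mixed terms between matrices and scalars.
  have h1 : (sgn α β : ℂ) * centralSum q x.2.1 = centralSum q x.2.1 := by
    by_cases hα : α = 1
    · simp [hx.2 hα]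
    · simp [sgn, hα]
  have h2 : (sgn α β : ℂ) * centralSum q y.2.1 = centralSum q y.2.1 := by
    by_cases hβ : β = 1
    · simp [hy.2 hβ]
    · simp [sgn, hβ]
  rw [hatOp_apply, hb, hk, hatOp_apply, hatOp_apply, ← Int.cast_smul_eq_zsmul ℂ]
  simp only [smul_mul_assoc, mul_smul_comm, add_mul, mul_add, one_mul, mul_one]
  -- The product of two halved operators gives `1/4`, and the factor `2` of `matOp_comm` restores
  -- the single `1/2`.
  linear_combination (norm := module) (-1 / 4 : ℂ) • hc
    + (1 / 4 * h1) • matOp τ ψ q y.1 + (1 / 4 * h2) • matOp τ ψ q x.1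
    + (1 / 4 * h1 * centralSum q y.2.1) • (1 : Module.End ℂ V)

/-! ### The grading -/

/-- The character of `ℤ/2`. -/
def paritySign (α : ZMod 2) : ℂ := if α = 0 then 1 else -1

lemma paritySign_add (α β : ZMod 2) :
    paritySign (α + β) = paritySign α * paritySign β := by
  have h : (1 : ZMod 2) + 1 = 0 := rfl
  rcases (by decide : ∀ γ : ZMod 2, γ = 0 ∨ γ = 1) α with rfl | rfl <;>
  rcases (by decide : ∀ γ : ZMod 2, γ = 0 ∨ γ = 1) β with rfl | rfl <;>
  simp [paritySign, h]

/-- Only indices of equal parity are paired by `form`, so contractions and shifts are even scalars.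
-/
lemma paritySign_form (r s : Ix N) : paritySign (par r + par s) * form r s = form r s := by
  have h : (1 : ZMod 2) + 1 = 0 := rfl
  rcases r with r | r | r <;> rcases s with s | s | s <;> simp [paritySign, form, par, h]

variable {P : Module.End ℂ V}

/-- Conjugation by `P` multiplies every term of the locally finite sum by the same sign, the product
of the signs of its two modes. -/
lemma mul_quadLin (h : IsFieldSystem ψ (eta τ) form)
    (hP : ∀ r m, P * ψ r m = paritySign (par r) • (ψ r m * P)) (r s : Ix N) (u : QTorus q) :
    P * quadLin ψ form q r s u = paritySign (par r + par s) • (quadLin ψ form q r s u * P) := by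
  induction u using QTorus.induction with
  | zero => simp
  | add u v hu hv => simp only [map_add, mul_add, add_mul, hu, hv, smul_add]
  | smul c u hu => simp only [map_smul, mul_smul_comm, smul_mul_assoc, hu, smul_comm c]
  | mono m n =>
    have hn (a b : ℤ) : P * normalProd ψ form r s a b
        = paritySign (par r + par s) • (normalProd ψ form r s a b * P) := by
      unfold normalProd
      rw [mul_sub, ← mul_assoc, hP, smul_mul_assoc, mul_assoc, hP, sub_mul, smul_sub]
      simp only [mul_smul_comm, smul_mul_assoc, mul_one, one_mul, smul_smul, paritySign_add,
        mul_ite, mul_zero, ← mul_assoc]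
      rw [← paritySign_add, paritySign_form]
    have hq : P * quad ψ form q r s m n
        = paritySign (par r + par s) • (quad ψ form q r s m n * P) := by
      have hs := h.hasLocSum_quad q r s m n
      refine (hs.mul_left P).unique (((hs.mul_right P).smul _).congr (fun k => ?_) rfl)
      rw [quadTerm, mul_smul_comm, hn, smul_mul_assoc, smul_comm]
    simp only [quadLin, lin_mono, quadShift, mul_sub, sub_mul, hq, smul_sub, mul_smul_comm,
      smul_mul_assoc, mul_one, one_mul, smul_smul, mul_ite, mul_zero, ← mul_assoc, paritySign_form]

lemma mul_hatOp (h : IsFieldSystem ψ (eta τ) form)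
    (hP : ∀ r m, P * ψ r m = paritySign (par r) • (ψ r m * P)) {α : ZMod 2} {x : Hat N q}
    (hx : HatHomog α x) : P * hatOp τ ψ q x = paritySign α • (hatOp τ ψ q x * P) := by
  have h1 : P * matOp τ ψ q x.1 = paritySign α • (matOp τ ψ q x.1 * P) := by
    simp only [matOp_apply, Finset.mul_sum, Finset.sum_mul, Finset.smul_sum]
    refine Finset.sum_congr rfl fun r _ => Finset.sum_congr rfl fun s _ => ?_
    by_cases hrs : par r + par s = α
    · simp only [unitOp, LinearMap.smul_apply, mul_smul_comm, smul_mul_assoc, mul_quadLin h hP,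
        par_dual, hrs]
      rw [smul_comm]
    · simp [apply_eq_zero_of_part_eq hx.1 hrs]
  have h2 : paritySign α * centralSum q x.2.1 = centralSum q x.2.1 := by
    by_cases hα : α = 1
    · simp [hx.2 hα]
    · have := (by decide : ∀ γ : ZMod 2, γ = 0 ∨ γ = 1) α
      simp [hα] at this
      simp [paritySign, this]
  rw [hatOp_apply, mul_smul_comm, mul_add, h1]
  simp only [smul_mul_assoc, add_mul, mul_smul_comm, mul_one, one_mul]
  linear_combination (norm := module) (-1 / 2 * h2) • P

/-- The eigenspaces of an involution. -/
def parityPart (P : Module.End ℂ V) (α : ZMod 2) : Submodule ℂ V :=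
  LinearMap.ker (P - paritySign α • 1)

lemma mem_parityPart {α : ZMod 2} {v : V} : v ∈ parityPart P α ↔ P v = paritySign α • v := by
  simp [parityPart, sub_eq_zero]

lemma isInternal_parityPart (hPP : P * P = 1) : DirectSum.IsInternal (parityPart P) := by
  rw [DirectSum.isInternal_submodule_iff_isCompl (parityPart P) (i := 0) (j := 1) (by decide)
    (by ext α; revert α; decide)]
  have hPP' (v : V) : P (P v) = v := congrArg (fun T => T v) hPP
  have s0 : paritySign 0 = 1 := by simp [paritySign]
  have s1 : paritySign 1 = -1 := by simp [paritySign]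
  constructor
  · rw [Submodule.disjoint_def]
    intro v h0 h1
    rw [mem_parityPart, s0, one_smul] at h0
    rw [mem_parityPart, s1, neg_one_smul, h0] at h1
    have h2 : (2 : ℂ) • v = 0 := by
      linear_combination (norm := module) h1
    exact (smul_eq_zero.1 h2).resolve_left two_ne_zero
  · rw [codisjoint_iff_le_sup]
    intro v _
    refine Submodule.mem_sup.2 ⟨(1 / 2 : ℂ) • (v + P v), ?_, (1 / 2 : ℂ) • (v - P v), ?_, ?_⟩
    · rw [mem_parityPart, s0, map_smul, map_add, hPP', add_comm, one_smul]
    · rw [mem_parityPart, s1, map_smul, map_sub, hPP', smul_comm, neg_one_smul, neg_sub]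
    · module

lemma isSuperModule_hatOp (h : IsFieldSystem ψ (eta τ) form) (hPP : P * P = 1)
    (hP : ∀ r m, P * ψ r m = paritySign (par r) • (ψ r m * P)) (L : Submodule ℂ (Hat N q))
    (hL : ∀ x ∈ L, ∀ y ∈ L, hatBracket x y ∈ L) (hLS : L ≤ Shat N q) :
    IsSuperModule L hL (hatOp τ ψ q ∘ₗ L.subtype) := by
  refine ⟨⟨parityPart P, isInternal_parityPart hPP, fun α β x hx v hv => ?_⟩,
    fun α β x y hx hy => hatOp_hatBracket h hx hy (hLS y.2)⟩
  rw [mem_parityPart] at hv ⊢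
  have := congrArg (fun T => T v) (mul_hatOp h hP hx)
  simp only [Module.End.mul_apply, LinearMap.smul_apply, hv, map_smul] at this
  rw [paritySign_add, mul_smul]
  exact this

/-! ### The operators of the generators -/

lemma hatOp_mat (X : Mat N q) : hatOp τ ψ q (X, 0) = (1 / 2 : ℂ) • matOp τ ψ q X := by
  simp [hatOp_apply]

/-- An element and its image under the involution of `S` act by the same operator up to `symSign`.
In a generator of `S` the two summands therefore contribute equally, which the factor `1/2` of
`hatOp` compensates in `hatOp_symm`. -/
lemma unitOp_dual (h : IsFieldSystem ψ (eta τ) form) (r s : Ix N) (u : QTorus q) :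
    unitOp τ ψ q (dual s) (dual r) (bar q u) = symSign τ r s • unitOp τ ψ q r s u := by
  simp only [unitOp, LinearMap.smul_apply, dual_dual, h.quadLin_swap q r (dual s) u, eta_dual_right,
    smul_smul, symSign]
  congr 1
  linear_combination - leftCoeff τ (dual s) * rightCoeff τ (dual r) * (eta_mul_self' (τ := τ) r s
    + eta τ r s * eta τ r s * leftCoeff_sq (τ := τ) r
    + eta τ r s * eta τ r s * leftCoeff τ r * leftCoeff τ r * rightCoeff_sq (τ := τ) s)

lemma symSign_sq (r s : Ix N) : symSign τ r s * symSign τ r s = 1 := by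
  have l2 := leftCoeff_sq (τ := τ) (N := N)
  have r2 := rightCoeff_sq (τ := τ) (N := N)
  calc _ = (leftCoeff τ r * leftCoeff τ r) * (rightCoeff τ s * rightCoeff τ s) *
      (leftCoeff τ (dual s) * leftCoeff τ (dual s)) *
      (rightCoeff τ (dual r) * rightCoeff τ (dual r)) * (eta τ r s * eta τ r s) := by
        unfold symSign; ring
    _ = 1 := by rw [l2, l2, r2, r2, eta_mul_self']; norm_num

lemma hatOp_symm (h : IsFieldSystem ψ (eta τ) form) (r s : Ix N) {c : ℂ} (hc : c = symSign τ r s)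
    (m n : ℤ) : hatOp τ ψ q (Matrix.single r s (mono q m n)
      + c • Matrix.single (dual s) (dual r) (bar q (mono q m n)), 0)
      = (leftCoeff τ r * rightCoeff τ s) • quadShift ψ form q r (dual s) m n := by
  rw [hatOp_mat, map_add, map_smul, matOp_single, matOp_single, unitOp_dual h, smul_smul, hc,
    symSign_sq, one_smul, ← two_smul ℂ, smul_smul]
  norm_num
  simp [unitOp, quadLin]

lemma hatOp_gMat (h : IsFieldSystem ψ (eta τ) form) (i j : Fin N) (m n : ℤ) :
    hatOp τ ψ q (gMat N q i j m n, 0) = ((τ : ℤ) : ℂ) • quadShift ψ form q (iA i) (iA j) m n := by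
  have := hatOp_symm (q := q) h (iA i) (iB j) (c := 1)
    (by simp [symSign, iA, iB, leftCoeff, rightCoeff, dual, eta, tau_sq]) m n
  simpa [gMat, iA, iB, leftCoeff, rightCoeff, dual] using this

lemma hatOp_fMat (h : IsFieldSystem ψ (eta τ) form) (i j : Fin N) (m n : ℤ) :
    hatOp τ ψ q (fMat N q i j m n, 0) = quadShift ψ form q (iA i) (iB j) m n := by
  have := hatOp_symm (q := q) h (iA i) (iA j) (c := -1)
    (by simp [symSign, iA, leftCoeff, rightCoeff, dual, eta, tau_sq]) m n
  simpa [fMat, iA, iB, leftCoeff, rightCoeff, dual, sub_eq_add_neg, tau_sq] using this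

lemma hatOp_hMat (h : IsFieldSystem ψ (eta τ) form) (i j : Fin N) (m n : ℤ) :
    hatOp τ ψ q (hMat N q i j m n, 0) = ((τ : ℤ) : ℂ) • quadShift ψ form q (iB i) (iB j) m n := by
  have := hatOp_symm (q := q) h (iB i) (iA j) (c := 1)
    (by simp [symSign, iA, iB, leftCoeff, rightCoeff, dual, eta, tau_sq]) m n
  -- `hMat` is minus the symmetric combination of matrix units, and `leftCoeff * rightCoeff` is `-τ`
  -- here.
  rw [← neg_inj, ← map_neg]
  simpa [hMat, iA, iB, leftCoeff, rightCoeff, dual, add_comm] using this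

lemma hatOp_eMat (h : IsFieldSystem ψ (eta τ) form) (i : Fin N) (m n : ℤ) :
    hatOp τ ψ q (eMat N q i m n, 0) = ((τ : ℤ) : ℂ) • quadShift ψ form q (iA i) (i0 N) m n := by
  have := hatOp_symm (q := q) h (iA i) (i0 N) (c := 1)
    (by simp [symSign, iA, i0, leftCoeff, rightCoeff, dual, eta, tau_sq]) m n
  rw [← neg_inj, ← map_neg]
  simpa [eMat, iA, iB, i0, leftCoeff, rightCoeff, dual, add_comm] using this

lemma hatOp_esMat (h : IsFieldSystem ψ (eta τ) form) (i : Fin N) (m n : ℤ) :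
    hatOp τ ψ q (esMat N q i m n, 0) = quadShift ψ form q (iB i) (i0 N) m n := by
  have := hatOp_symm (q := q) h (iB i) (i0 N) (c := -1)
    (by simp [symSign, iB, i0, leftCoeff, rightCoeff, dual, eta, tau_sq]) m n
  simpa [esMat, iA, iB, i0, leftCoeff, rightCoeff, dual, sub_eq_add_neg] using this

lemma hatOp_e0Mat (h : IsFieldSystem ψ (eta τ) form) (m n : ℤ) :
    hatOp τ ψ q (e0Mat N q m n, 0) = quadShift ψ form q (i0 N) (i0 N) m n := by
  have := hatOp_symm (q := q) h (i0 N) (i0 N) (c := -1)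
    (by simp [symSign, i0, leftCoeff, rightCoeff, dual, eta]) m n
  rw [← neg_inj, ← map_neg]
  simpa [e0Mat, i0, leftCoeff, rightCoeff, dual, sub_eq_add_neg, Matrix.single_add,
    ← Matrix.single_neg] using this

lemma hatOp_c (k : Lam q) : hatOp τ ψ q (0, Finsupp.single k 1, 0) = (1 / 2 : ℂ) • 1 := by
  rw [hatOp_apply, centralSum, Finsupp.linearCombination_single]
  simp

lemma hatOp_cy : hatOp τ ψ q (0, 0, 1) = 0 := by
  simp [hatOp_apply]

end

/-! ### The parity operator of the Fock space -/

/-- The operator that multiplies by `(-1) ^ d` on polynomials of degree `d`. -/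
def bosParity (N : ℕ) : Module.End ℂ (Fock N) := TensorProduct.map (twist N 1) LinearMap.id

lemma bosParity_mul_self (N : ℕ) : bosParity N * bosParity N = 1 := by
  rw [bosParity, ← TensorProduct.map_mul, twist_twist]
  exact TensorProduct.map_one

lemma twist_comm (N : ℕ) (τ : ℤˣ) : twist N 1 * twist N τ = twist N τ * twist N 1 := by
  rcases Int.units_eq_one_or τ with rfl | rfl
  · rfl
  · have : twist N (-1) = 1 := by
      refine LinearMap.ext fun p => ?_
      simp [twist]
    rw [this, one_mul, mul_one]

/-- A bosonic mode changes the polynomial degree by one and anticommutes with the parity. The mode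
`e(m)` acts on polynomials only through `twist`, which preserves degrees, so it commutes with the
parity. -/
lemma bosParity_mul {N : ℕ} (τ : ℤˣ) (lam : ℂ) (r : Ix N) (m : ℤ) :
    bosParity N * genField (genAct N τ lam) r m
      = paritySign (par r) • (genField (genAct N τ lam) r m * bosParity N) := by
  have tmul (f f' : Module.End ℂ (Bos N)) (g g' : Module.End ℂ Fer) :
      (TensorProduct.map f g * TensorProduct.map f' g' : Module.End ℂ (Fock N))
        = TensorProduct.map (f * f') (g * g') := (TensorProduct.map_mul f f' g g').symm
  rcases r with r | i | i
  · simp only [genField, genAct, bosParity, tmul, twist_comm, paritySign, par, if_true, one_smul]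
    rfl
  · simp only [genField, genAct, bosParity, tmul, bosA_twist]
    rw [TensorProduct.map_smul_left, smul_smul]
    simp [paritySign, par]
  · simp only [genField, genAct, bosParity, tmul, bosAs_twist]
    rw [TensorProduct.map_smul_left, smul_smul]
    simp [paritySign, par]

end QT

end

theorem mainTheorem1 (N : ℕ) (hN : 1 ≤ N) (q : ℂˣ) (τ : ℤˣ) (lam : ℂ)
    (hlam : lam ^ 2 = -1 / 2) :
    QT.AllLocFin N q τ lam hlam ∧
    ∃ π : QT.Shat N q →ₗ[ℂ] Module.End ℂ (QT.Fock N),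
      (∀ i j m n, π (QT.gT N q i j m n) = ((τ : ℤ) : ℂ) • QT.opG N q τ lam hlam i j m n) ∧
      (∀ i j m n, π (QT.fT N q i j m n) = QT.opF N q τ lam hlam i j m n) ∧
      (∀ i j m n, π (QT.hT N q i j m n) = ((τ : ℤ) : ℂ) • QT.opH N q τ lam hlam i j m n) ∧
      (∀ i m n, π (QT.eT N q i m n) = ((τ : ℤ) : ℂ) • QT.opE N q τ lam hlam i m n) ∧
      (∀ i m n, π (QT.esT N q i m n) = QT.opEs N q τ lam hlam i m n) ∧
      (∀ m n, π (QT.e0T N q m n) = QT.opE0 N q τ lam hlam m n) ∧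
      (∀ k : QT.Lam q, π (QT.cT N q k) = (1 / 2 : ℂ) • 1) ∧
      π (QT.cyT N q) = 0 ∧
      QT.IsSuperModule (QT.Shat N q) (QT.Shat_closed N q) π ∧
      QT.IsSuperModule (QT.Ghat N q) (QT.Ghat_closed N q)
        (π.comp (Submodule.inclusion (QT.Ghat_le_Shat N q))) := by
  have h := QT.isFieldSystem_genAct (N := N) (τ := τ) hlam
  have hP := QT.bosParity_mul (N := N) τ lam
  have hPP := QT.bosParity_mul_self N
  refine ⟨QT.allLocFin, QT.hatOp (V := QT.Fock N) τ (QT.genField (QT.genAct N τ lam)) q ∘ₗ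
    (QT.Shat N q).subtype, fun i j m n => ?_, fun i j m n => ?_, fun i j m n => ?_,
    fun i m n => ?_, fun i m n => ?_, fun m n => ?_, fun k => ?_, ?_, ?_, ?_⟩
  · rw [QT.opG_eq]
    exact QT.hatOp_gMat h i j m n
  · rw [QT.opF_eq]
    exact QT.hatOp_fMat h i j m n
  · rw [QT.opH_eq]
    exact QT.hatOp_hMat h i j m n
  · rw [QT.opE_eq]
    exact QT.hatOp_eMat h i m n
  · rw [QT.opEs_eq]
    exact QT.hatOp_esMat h i m n
  · rw [QT.opE0_eq]
    exact QT.hatOp_e0Mat h m n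
  · exact QT.hatOp_c (V := QT.Fock N) k
  · exact QT.hatOp_cy (V := QT.Fock N)
  · exact QT.isSuperModule_hatOp (V := QT.Fock N) h hPP hP (QT.Shat N q) (QT.Shat_closed N q) le_rfl
  · exact QT.isSuperModule_hatOp (V := QT.Fock N) h hPP hP (QT.Ghat N q) (QT.Ghat_closed N q)
      (QT.Ghat_le_Shat N q)
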